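/- Let $M$ be a smooth ($C^\infty$, Hausdorff) $n$-dimensional manifold with a smooth affine connection $\nabla$, and let $e\in M$. Let $N_e$ be a restricted normal neighbourhood of $e$: an open set such that $\exp_e$ maps some open neighbourhood $N_0$ of $0$ in $T_eM$ diffeomorphically onto $N_e$, and such that any two points of $N_e$ are joined by exactly one geodesic segment $[0,1]\to N_e$. Below, $\exp_e^{-1}:N_e\to N_0$ is the inverse of this diffeomorphism. For $x,y\in N_e$ let $\gamma_y$ be the geodesic segment in $N_e$ from $e$ to $y$, let $T_{\gamma_y}:T_eM\to T_yM$ be the parallel transport along it, and define the product of the geodesic loop $\mathcal L_e$ by $$xy=\exp_y\bigl(T_{\gamma_y}(\exp_e^{-1}(x))\bigr)$$ whenever the right-hand side is defined and lies in $N_e$. Theorem. Suppose that $\nabla$ is torsion-free and that $\mathcal L_e$ is left diassociative, i.e. $x(xy)=(xx)y$ for all $x,y\in N_e$ for which both sides are defined. Then the curvature tensor $R(X,Y)Z=\nabla_X\nabla_YZ-\nabla_Y\nabla_XZ-\nabla_{[X,Y]}Z$ vanishes at $e$, i.e. $(R(X,Y)Z)(e)=0$ for all smooth vector fields $X,Y,Z$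 on $M$. -/

import Mathlib

open Set Bundle VectorField
open scoped Manifold ContDiff

noncomputable section

/-!
An affine connection on a smooth manifold `M` modelled on `E` is Mathlib's `CovariantDerivative` on
the tangent bundle: `cov Y p (X p)` is `(∇_X Y)(p)`.
-/

namespace GeodesicLoop

variable {E : Type*} [NormedAddCommGroup E] [NormedSpace ℝ E]
  {M : Type*} [TopologicalSpace M] [ChartedSpace E M] [IsManifold 𝓘(ℝ, E) ∞ M]

/-- The velocity `γ'(t)` of a curve `γ`, a tangent vector at `γ t`. -/
def velocity (γ : ℝ → M) (t : ℝ) : TangentSpace 𝓘(ℝ, E) (γ t) :=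
  mfderiv 𝓘(ℝ, ℝ) 𝓘(ℝ, E) γ t (1 : ℝ)

/-- The covariant derivative `D_t V` at time `t` of a vector field `V` along a curve `γ`.
In the coordinate frame `∂_k` of the chart at `γ t`, where `V = V^k ∂_k`, this is
`(dV^k/dt) ∂_k + V^j ∇_{γ'} ∂_j`. The first summand is the derivative of the coordinate expression
of `V`; the second is `∇_{γ'}` of the field `FiberBundle.extend E (V t)`, which has in that frame
the constant coefficients `V^j(t)`. -/
def covDerivAlong (cov : CovariantDerivative 𝓘(ℝ, E) E (TangentSpace 𝓘(ℝ, E) : M → Type _))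
    (γ : ℝ → M) (V : ∀ t : ℝ, TangentSpace 𝓘(ℝ, E) (γ t)) (t : ℝ) :
    TangentSpace 𝓘(ℝ, E) (γ t) :=
  (trivializationAt E (TangentSpace 𝓘(ℝ, E) : M → Type _) (γ t)).symm (γ t)
      (deriv (fun s : ℝ =>
        ((trivializationAt E (TangentSpace 𝓘(ℝ, E) : M → Type _) (γ t))
          (⟨γ s, V s⟩ : TangentBundle 𝓘(ℝ, E) M)).2) t)
    + cov (FiberBundle.extend E (V t)) (γ t) (velocity γ t)

/-- `V` is a smooth vector field along `γ`, parallel for `cov`, on the open set `J` of times. -/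
structure IsParallelOn
    (cov : CovariantDerivative 𝓘(ℝ, E) E (TangentSpace 𝓘(ℝ, E) : M → Type _))
    (γ : ℝ → M) (V : ∀ t : ℝ, TangentSpace 𝓘(ℝ, E) (γ t)) (J : Set ℝ) : Prop where
  smooth : ContMDiffOn 𝓘(ℝ, ℝ) 𝓘(ℝ, E).tangent ∞
    (fun t : ℝ => (⟨γ t, V t⟩ : TangentBundle 𝓘(ℝ, E) M)) J
  parallel : ∀ t ∈ J, covDerivAlong cov γ V t = 0

/-- `γ` is a smooth curve with `D_t γ' = 0` on the open set `J` of times. -/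
structure IsGeodesicOn
    (cov : CovariantDerivative 𝓘(ℝ, E) E (TangentSpace 𝓘(ℝ, E) : M → Type _))
    (γ : ℝ → M) (J : Set ℝ) : Prop where
  smooth : ContMDiffOn 𝓘(ℝ, ℝ) 𝓘(ℝ, E) ∞ γ J
  geodesic : ∀ t ∈ J, covDerivAlong cov γ (velocity γ) t = 0

/-- `q = exp ξ`: the geodesic with initial velocity `ξ` is defined on a neighbourhood of `[0, 1]`
and has the value `q` at time `1`. -/
def IsExp (cov : CovariantDerivative 𝓘(ℝ, E) E (TangentSpace 𝓘(ℝ, E) : M → Type _))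
    (ξ : TangentBundle 𝓘(ℝ, E) M) (q : M) : Prop :=
  ∃ (J : Set ℝ) (γ : ℝ → M), IsOpen J ∧ Icc 0 1 ⊆ J ∧ IsGeodesicOn cov γ J ∧
    (⟨γ 0, velocity γ 0⟩ : TangentBundle 𝓘(ℝ, E) M) = ξ ∧ γ 1 = q

/-- `γ` restricts to a geodesic segment `[0, 1] → N` from `a` to `b`; it is a geodesic on the open
neighbourhood `J` of `[0, 1]`. -/
structure IsSegmentIn
    (cov : CovariantDerivative 𝓘(ℝ, E) E (TangentSpace 𝓘(ℝ, E) : M → Type _))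
    (N : Set M) (a b : M) (γ : ℝ → M) (J : Set ℝ) : Prop where
  isOpen : IsOpen J
  subset : Icc 0 1 ⊆ J
  geodesic : IsGeodesicOn cov γ J
  source : γ 0 = a
  target : γ 1 = b
  mapsTo : MapsTo γ (Icc 0 1) N

/-- The open set `Φ.target` is a restricted normal neighbourhood `N_e` of `e`: the exponential map
`exp_e` restricts to the diffeomorphism `Φ` from the open neighbourhood `Φ.source` of `0` in `T_e M`
onto `N_e`, and any two points of `N_e` are joined by exactly one geodesic segment
`[0, 1] → N_e`. (As a type, `T_e M` is `E`.) -/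
structure IsRestrictedNormalNhd
    (cov : CovariantDerivative 𝓘(ℝ, E) E (TangentSpace 𝓘(ℝ, E) : M → Type _))
    (e : M) (Φ : OpenPartialHomeomorph E M) : Prop where
  zero_mem : (0 : E) ∈ Φ.source
  isExp : ∀ v ∈ Φ.source, IsExp cov (⟨e, v⟩ : TangentBundle 𝓘(ℝ, E) M) (Φ v)
  smooth : ContMDiffOn 𝓘(ℝ, E) 𝓘(ℝ, E) ∞ Φ Φ.source
  smooth_symm : ContMDiffOn 𝓘(ℝ, E) 𝓘(ℝ, E) ∞ Φ.symm Φ.target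
  exists_segment : ∀ a ∈ Φ.target, ∀ b ∈ Φ.target, ∃ γ J, IsSegmentIn cov Φ.target a b γ J
  unique_segment : ∀ a ∈ Φ.target, ∀ b ∈ Φ.target, ∀ γ₁ J₁ γ₂ J₂,
    IsSegmentIn cov Φ.target a b γ₁ J₁ → IsSegmentIn cov Φ.target a b γ₂ J₂ →
    EqOn γ₁ γ₂ (Icc 0 1)

/-- `z = x · y` in the geodesic loop on `N_e = Φ.target`: the points `x`, `y`, `z` lie in `N_e` and
`z = exp_y (T_γ (exp_e⁻¹ x))`, where `T_γ` is the parallel transport from `0` to `1` along the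
geodesic segment `γ` of `N_e` from `e` to `y`. The product is local: there may be no such `z`. -/
def IsProduct (cov : CovariantDerivative 𝓘(ℝ, E) E (TangentSpace 𝓘(ℝ, E) : M → Type _))
    (e : M) (Φ : OpenPartialHomeomorph E M) (x y z : M) : Prop :=
  x ∈ Φ.target ∧ y ∈ Φ.target ∧ z ∈ Φ.target ∧
    ∃ (J : Set ℝ) (γ : ℝ → M) (V : ∀ t : ℝ, TangentSpace 𝓘(ℝ, E) (γ t)),
      IsSegmentIn cov Φ.target e y γ J ∧ IsParallelOn cov γ V J ∧
      (⟨γ 0, V 0⟩ : TangentBundle 𝓘(ℝ, E) M) = ⟨e, Φ.symm x⟩ ∧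
      IsExp cov (⟨γ 1, V 1⟩ : TangentBundle 𝓘(ℝ, E) M) z

/-- The geodesic loop on `N_e = Φ.target` is left diassociative: `x (x y) = (x x) y` for all `x`,
`y` in `N_e` for which these products are defined. -/
def IsLeftDiassociative
    (cov : CovariantDerivative 𝓘(ℝ, E) E (TangentSpace 𝓘(ℝ, E) : M → Type _))
    (e : M) (Φ : OpenPartialHomeomorph E M) : Prop :=
  ∀ x y xy xx r s : M, IsProduct cov e Φ x y xy → IsProduct cov e Φ x xy r →
    IsProduct cov e Φ x x xx → IsProduct cov e Φ xx y s → r = s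

/-- The curvature `R(X, Y) Z = ∇_X ∇_Y Z - ∇_Y ∇_X Z - ∇_[X, Y] Z` of vector fields, at `p`. -/
def curvature (cov : CovariantDerivative 𝓘(ℝ, E) E (TangentSpace 𝓘(ℝ, E) : M → Type _))
    (X Y Z : ∀ p : M, TangentSpace 𝓘(ℝ, E) p) (p : M) : TangentSpace 𝓘(ℝ, E) p :=
  cov (fun q => cov Z q (Y q)) p (X p) - cov (fun q => cov Z q (X q)) p (Y p)
    - cov Z p (mlieBracket 𝓘(ℝ, E) X Y p)

end GeodesicLoop

end

noncomputable section

set_option maxSynthPendingDepth 3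

/-! ### Components of vector fields in a smooth parametrization -/

namespace GeodesicLoop

open Filter Topology

variable {E : Type*} [NormedAddCommGroup E] [NormedSpace ℝ E]
  {M : Type*} [TopologicalSpace M] [ChartedSpace E M]

/-! Everything is read in the normal coordinates given by `Φ`. Let `Γ` be the Christoffel symbols
there and `A` the derivative of `Γ` at the origin; `A x v u` differentiates in direction `x`, and
`v`, `u` are the transported vector and the direction of transport. Vanishing torsion makes `Γ`,
hence `A x`, symmetric. Since radial lines are geodesics, `Γ (s • v) v v = 0` for small `s > 0`;
this gives `Γ 0 = 0` and `A v v v = 0`.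

Parallel transport of `a` along the radial geodesic to `b` gives `a - ½ A b a b` to third order.
Shooting a geodesic from `b` with that velocity adds `-½ A b a a`; its purely cubic term `A a a a`
vanishes. So the loop product is `a + b - ½ A b a b - ½ A b a a + o(3)` (`exists_isProduct`).

Insert this in `x(xy) = (xx)y`. All terms of order at most three cancel except for `A y x x = A x x
y` (`trilinear_symm_of_product`). Polarizing `A v v v = 0` then gives `3 A y x x = 0`, and
polarizing in `x` gives `A = 0` (`trilinear_eq_zero`). Now `Γ` vanishes to first order at the
origin, and the curvature at `e` involves only `Γ` and its first derivative there
(`IsChristoffel.curvature_eq_zero`).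

Two analytic facts support this. Small geodesics and transports exist up to time 1 with linear
control of their size (`exists_isGeodesicSol`). Any geodesic on `M` starting with the same data
agrees with a coordinate solution (`IsExp.eq_of_isGeodesicSol`), so the relation `IsExp` can be
computed in coordinates. -/

theorem two_le_infty : (2 : ℕ∞ω) ≤ ∞ := WithTop.coe_le_coe.2 (le_top : (2 : ℕ∞) ≤ ⊤)

theorem three_le_infty : (3 : ℕ∞ω) ≤ ∞ := WithTop.coe_le_coe.2 (le_top : (3 : ℕ∞) ≤ ⊤)

theorem mlieBracket_model_apply (V W : E → E) (z : E) :
    mlieBracket 𝓘(ℝ, E) V W z = fderiv ℝ W z (V z) - fderiv ℝ V z (W z) := by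
  have h := congrFun (mlieBracketWithin_eq_lieBracketWithin (𝕜 := ℝ) (V := V) (W := W)
    (s := univ)) z
  exact h.trans (congrFun (lieBracketWithin_univ (𝕜 := ℝ) (V := V) (W := W)) z)

/-- `Ψ` is a smooth parametrization of the open set `Ψ.target` of `M`. -/
structure IsParametrization (Ψ : OpenPartialHomeomorph E M) : Prop where
  smooth : ContMDiffOn 𝓘(ℝ, E) 𝓘(ℝ, E) ∞ Ψ Ψ.source
  smooth_symm : ContMDiffOn 𝓘(ℝ, E) 𝓘(ℝ, E) ∞ Ψ.symm Ψ.target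

/-- The tangent vector at `Ψ z` with components `v`. -/
def pushVec (Ψ : OpenPartialHomeomorph E M) (z : E) : E →L[ℝ] TangentSpace 𝓘(ℝ, E) (Ψ z) :=
  mfderiv 𝓘(ℝ, E) 𝓘(ℝ, E) Ψ z

/-- The components of a tangent vector at `p`. -/
def comp (Ψ : OpenPartialHomeomorph E M) (p : M) : TangentSpace 𝓘(ℝ, E) p →L[ℝ] E :=
  mfderiv 𝓘(ℝ, E) 𝓘(ℝ, E) Ψ.symm p

/-- The components of a vector field. -/
def comps (Ψ : OpenPartialHomeomorph E M) (X : ∀ p : M, TangentSpace 𝓘(ℝ, E) p) (z : E) : E :=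
  comp Ψ (Ψ z) (X (Ψ z))

/-- The vector field with components `V`. -/
def field (Ψ : OpenPartialHomeomorph E M) (V : E → E) (p : M) : TangentSpace 𝓘(ℝ, E) p :=
  (comp Ψ p).inverse (V (Ψ.symm p))

namespace IsParametrization

variable {Ψ : OpenPartialHomeomorph E M} (hΨ : IsParametrization Ψ)
include hΨ

theorem mdifferentiable : Ψ.MDifferentiable 𝓘(ℝ, E) 𝓘(ℝ, E) :=
  ⟨hΨ.smooth.mdifferentiableOn (by simp), hΨ.smooth_symm.mdifferentiableOn (by simp)⟩

theorem contMDiffAt {z : E} (hz : z ∈ Ψ.source) : ContMDiffAt 𝓘(ℝ, E) 𝓘(ℝ, E) ∞ Ψ z :=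
  hΨ.smooth.contMDiffAt (Ψ.open_source.mem_nhds hz)

theorem contMDiffAt_symm {p : M} (hp : p ∈ Ψ.target) :
    ContMDiffAt 𝓘(ℝ, E) 𝓘(ℝ, E) ∞ Ψ.symm p :=
  hΨ.smooth_symm.contMDiffAt (Ψ.open_target.mem_nhds hp)

theorem comp_pushVec {z : E} (hz : z ∈ Ψ.source) (v : E) :
    comp Ψ (Ψ z) (pushVec Ψ z v) = v :=
  congrArg (fun L => L v) (hΨ.mdifferentiable.symm_comp_deriv hz)

theorem comp_injective {p : M} (hp : p ∈ Ψ.target) : Function.Injective (comp Ψ p) :=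
  hΨ.mdifferentiable.symm.mfderiv_injective hp

theorem pushVec_comp {z : E} (hz : z ∈ Ψ.source) (ξ : TangentSpace 𝓘(ℝ, E) (Ψ z)) :
    pushVec Ψ z (comp Ψ (Ψ z) ξ) = ξ :=
  hΨ.comp_injective (Ψ.map_source hz) (hΨ.comp_pushVec hz _)

theorem isInvertible_pushVec {z : E} (hz : z ∈ Ψ.source) : (pushVec Ψ z).IsInvertible :=
  ⟨hΨ.mdifferentiable.mfderiv hz, rfl⟩

theorem isInvertible_comp {p : M} (hp : p ∈ Ψ.target) : (comp Ψ p).IsInvertible :=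
  ⟨hΨ.mdifferentiable.symm.mfderiv hp, rfl⟩

/-- Identifies components with a pullback, so that smoothness and naturality of the Lie bracket can
be taken from the theory of pulled-back fields. -/
theorem comps_eq_mpullback (X : ∀ p : M, TangentSpace 𝓘(ℝ, E) p) {z : E} (hz : z ∈ Ψ.source) :
    comps Ψ X z = mpullback 𝓘(ℝ, E) 𝓘(ℝ, E) Ψ X z := by
  obtain ⟨L, hL⟩ := hΨ.isInvertible_pushVec hz
  change comps Ψ X z = (pushVec Ψ z).inverse (X (Ψ z))
  rw [← hΨ.pushVec_comp hz (X (Ψ z)), ← hL, ContinuousLinearMap.inverse_equiv]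
  exact (L.symm_apply_apply (comps Ψ X z)).symm

theorem eventuallyEq_mpullback (X : ∀ p : M, TangentSpace 𝓘(ℝ, E) p) {z : E}
    (hz : z ∈ Ψ.source) : comps Ψ X =ᶠ[𝓝 z] mpullback 𝓘(ℝ, E) 𝓘(ℝ, E) Ψ X :=
  eventually_of_mem (Ψ.open_source.mem_nhds hz) fun _ h => hΨ.comps_eq_mpullback X h

theorem comp_field {p : M} (hp : p ∈ Ψ.target) (V : E → E) :
    comp Ψ p (field Ψ V p) = V (Ψ.symm p) :=
  ((hΨ.isInvertible_comp hp).inverse_apply_eq.1 rfl).symm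

theorem comps_field {z : E} (hz : z ∈ Ψ.source) (V : E → E) : comps Ψ (field Ψ V) z = V z := by
  rw [comps, hΨ.comp_field (Ψ.map_source hz), Ψ.left_inv hz]

theorem field_apply {z : E} (hz : z ∈ Ψ.source) (V : E → E) :
    field Ψ V (Ψ z) = pushVec Ψ z (V z) := by
  apply hΨ.comp_injective (Ψ.map_source hz)
  rw [hΨ.comp_field (Ψ.map_source hz), Ψ.left_inv hz, hΨ.comp_pushVec hz]

variable [CompleteSpace E] [IsManifold 𝓘(ℝ, E) ∞ M]

theorem contDiffAt_comps {X : ∀ p : M, TangentSpace 𝓘(ℝ, E) p} {z : E} (hz : z ∈ Ψ.source)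
    (hX : ContMDiffAt 𝓘(ℝ, E) 𝓘(ℝ, E).tangent ∞
      (fun p => (⟨p, X p⟩ : TangentBundle 𝓘(ℝ, E) M)) (Ψ z)) :
    ContDiffAt ℝ ∞ (comps Ψ X) z := by
  refine ContDiffAt.congr_of_eventuallyEq ?_ (hΨ.eventuallyEq_mpullback X hz)
  have := hX.mpullback_vectorField_preimage (hΨ.contMDiffAt hz) (hΨ.isInvertible_pushVec hz) le_rfl
  exact contMDiffAt_vectorSpace_iff_contDiffAt.1 this

theorem differentiableAt_comps {X : ∀ p : M, TangentSpace 𝓘(ℝ, E) p} {z : E}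
    (hz : z ∈ Ψ.source)
    (hX : MDifferentiableAt 𝓘(ℝ, E) 𝓘(ℝ, E).tangent
      (fun p => (⟨p, X p⟩ : TangentBundle 𝓘(ℝ, E) M)) (Ψ z)) :
    DifferentiableAt ℝ (comps Ψ X) z := by
  refine DifferentiableAt.congr_of_eventuallyEq ?_ (hΨ.eventuallyEq_mpullback X hz)
  have : IsManifold 𝓘(ℝ, E) 2 M := .of_le (n := ∞) two_le_infty
  have := hX.mpullback_vectorField ((hΨ.contMDiffAt hz).of_le (m := 2) two_le_infty)
    (hΨ.isInvertible_pushVec hz) le_rfl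
  rw [mdifferentiableAt_totalSpace] at this
  have h2 := this.2
  simp only [trivializationAt_model_space_apply] at h2
  exact h2.differentiableAt

theorem contMDiffAt_field {V : E → E} {z : E} (hz : z ∈ Ψ.source) (hV : ContDiffAt ℝ ∞ V z) :
    ContMDiffAt 𝓘(ℝ, E) 𝓘(ℝ, E).tangent ∞
      (fun p => (⟨p, field Ψ V p⟩ : TangentBundle 𝓘(ℝ, E) M)) (Ψ z) := by
  have hp := Ψ.map_source hz
  have hV' : ContDiffAt ℝ ∞ V (Ψ.symm (Ψ z)) := by rwa [Ψ.left_inv hz]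
  exact (contMDiffAt_vectorSpace_iff_contDiffAt (𝕜 := ℝ) (E := E) (V := V)
    |>.2 hV').mpullback_vectorField_preimage (n := ∞) (hΨ.contMDiffAt_symm hp)
    (hΨ.isInvertible_comp hp) le_rfl

theorem contMDiffOn_field {V : E → E} (hV : ContDiffOn ℝ ∞ V Ψ.source) :
    ContMDiffOn 𝓘(ℝ, E) 𝓘(ℝ, E).tangent ∞
      (fun p => (⟨p, field Ψ V p⟩ : TangentBundle 𝓘(ℝ, E) M)) Ψ.target := by
  intro p hp
  have := hΨ.contMDiffAt_field (Ψ.map_target hp)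
    (hV.contDiffAt (Ψ.open_source.mem_nhds (Ψ.map_target hp)))
  rw [Ψ.right_inv hp] at this
  exact this.contMDiffWithinAt

/-- Components of the Lie bracket. -/
theorem comps_mlieBracket {X Y : ∀ p : M, TangentSpace 𝓘(ℝ, E) p} {z : E} (hz : z ∈ Ψ.source)
    (hX : MDifferentiableAt 𝓘(ℝ, E) 𝓘(ℝ, E).tangent
      (fun p => (⟨p, X p⟩ : TangentBundle 𝓘(ℝ, E) M)) (Ψ z))
    (hY : MDifferentiableAt 𝓘(ℝ, E) 𝓘(ℝ, E).tangent
      (fun p => (⟨p, Y p⟩ : TangentBundle 𝓘(ℝ, E) M)) (Ψ z)) :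
    comps Ψ (mlieBracket 𝓘(ℝ, E) X Y) z =
      fderiv ℝ (comps Ψ Y) z (comps Ψ X z) - fderiv ℝ (comps Ψ X) z (comps Ψ Y z) := by
  have : IsManifold 𝓘(ℝ, E) (minSmoothness ℝ 3) M :=
    .of_le (n := ∞) (by simpa using three_le_infty)
  have : IsManifold 𝓘(ℝ, E) (minSmoothness ℝ 2) M :=
    .of_le (n := ∞) (by simpa using two_le_infty)
  rw [hΨ.comps_eq_mpullback _ hz,
    mpullback_mlieBracket hX hY ((hΨ.contMDiffAt hz).of_le (m := 2) two_le_infty) (by simp),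
    (hΨ.eventuallyEq_mpullback X hz).fderiv_eq, (hΨ.eventuallyEq_mpullback Y hz).fderiv_eq,
    hΨ.comps_eq_mpullback X hz, hΨ.comps_eq_mpullback Y hz]
  exact mlieBracket_model_apply _ _ _

end IsParametrization

end GeodesicLoop

/-! ### Christoffel symbols and curvature in coordinates -/

namespace GeodesicLoop

open Filter Topology

variable {E : Type*} [NormedAddCommGroup E] [NormedSpace ℝ E] [FiniteDimensional ℝ E]
  {M : Type*} [TopologicalSpace M] [ChartedSpace E M] [IsManifold 𝓘(ℝ, E) ∞ M]

/-- `Γ z v u` are the components of `∇_u ∂_v` at `Ψ z`, where `∂_v` has constant components `v`. -/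
def IsChristoffel (cov : CovariantDerivative 𝓘(ℝ, E) E (TangentSpace 𝓘(ℝ, E) : M → Type _))
    (Ψ : OpenPartialHomeomorph E M) (Γ : E → E →L[ℝ] E →L[ℝ] E) : Prop :=
  ∀ z ∈ Ψ.source, ∀ X : ∀ p : M, TangentSpace 𝓘(ℝ, E) p,
    MDifferentiableAt 𝓘(ℝ, E) 𝓘(ℝ, E).tangent
      (fun p => (⟨p, X p⟩ : TangentBundle 𝓘(ℝ, E) M)) (Ψ z) →
    ∀ u : E, comp Ψ (Ψ z) (cov X (Ψ z) (pushVec Ψ z u)) =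
      fderiv ℝ (comps Ψ X) z u + Γ z (comps Ψ X z) u

variable (cov : CovariantDerivative 𝓘(ℝ, E) E (TangentSpace 𝓘(ℝ, E) : M → Type _))
  {Ψ : OpenPartialHomeomorph E M}

/-- The Leibniz terms of the connection and of the coordinate derivative cancel, so their difference
is tensorial in the field and depends only on its value at the point. -/
theorem IsParametrization.exists_isChristoffel (hΨ : IsParametrization Ψ) :
    ∃ Γ, IsChristoffel cov Ψ Γ := by
  have key : ∀ z ∈ Ψ.source, TensorialAt 𝓘(ℝ, E) E
      (fun X : ∀ p : M, TangentSpace 𝓘(ℝ, E) p =>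
        ((comp Ψ (Ψ z)).comp ((cov X (Ψ z)).comp (pushVec Ψ z)) - fderiv ℝ (comps Ψ X) z :
          E →L[ℝ] E)) (Ψ z) := by
    intro z hz
    constructor
    · intro f X hf hX
      have h1 : comps Ψ (f • X) = fun y => f (Ψ y) • comps Ψ X y := by
        ext1 y
        simp [comps]
      have hg : DifferentiableAt ℝ (fun y => f (Ψ y)) z :=
        (hf.comp z (hΨ.mdifferentiable.mdifferentiableAt hz)).differentiableAt
      have h2 : fderiv ℝ (fun y => f (Ψ y)) z = (mvfderiv 𝓘(ℝ, E) f (Ψ z)).comp (pushVec Ψ z) := by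
        have := mfderiv_comp z hf (hΨ.mdifferentiable.mdifferentiableAt hz)
        rw [mfderiv_eq_fderiv] at this
        exact this
      have h3 := cov.isCovariantDerivativeOnUniv.leibniz hX hf (mem_univ _)
      ext u
      rw [h1, fderiv_fun_smul hg (hΨ.differentiableAt_comps hz hX), h3, h2]
      simp [comps, smul_sub]
    · intro X Y hX hY
      have h1 : comps Ψ (X + Y) = fun y => comps Ψ X y + comps Ψ Y y := by
        ext1 y
        simp [comps]
      have h3 := cov.isCovariantDerivativeOnUniv.add hX hY (mem_univ _)
      ext u
      rw [h1, fderiv_fun_add (hΨ.differentiableAt_comps hz hX) (hΨ.differentiableAt_comps hz hY),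
        h3]
      simp
      abel
  have : IsManifold 𝓘(ℝ, E) 2 M := .of_le (n := ∞) two_le_infty
  choose! Γ hΓ using fun z (hz : z ∈ Ψ.source) =>
    (⟨(TensorialAt.mkHom _ _ (key z hz)).comp (pushVec Ψ z), rfl⟩ : ∃ L : E →L[ℝ] E →L[ℝ] E,
      L = (TensorialAt.mkHom _ _ (key z hz)).comp (pushVec Ψ z))
  refine ⟨Γ, fun z hz X hX u => ?_⟩
  rw [hΓ z hz, ContinuousLinearMap.comp_apply, comps, hΨ.pushVec_comp hz,
    TensorialAt.mkHom_apply (key z hz) hX]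
  simp

namespace IsChristoffel

variable {cov} {Γ : E → E →L[ℝ] E →L[ℝ] E} (hΓ : IsChristoffel cov Ψ Γ)
include hΓ

theorem comp_cov_field_const (hΨ : IsParametrization Ψ) {z : E} (hz : z ∈ Ψ.source) (u v : E) :
    comp Ψ (Ψ z) (cov (field Ψ fun _ => v) (Ψ z) (pushVec Ψ z u)) = Γ z v u := by
  rw [hΓ z hz _ ((hΨ.contMDiffAt_field hz contDiffAt_const).mdifferentiableAt (by simp)) u,
    hΨ.comps_field hz]
  have : comps Ψ (field Ψ fun _ => v) =ᶠ[𝓝 z] fun _ => v :=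
    eventually_of_mem (Ψ.open_source.mem_nhds hz) fun y hy => hΨ.comps_field hy _
  rw [this.fderiv_eq]
  simp

/-- Smoothness of the connection is applied to globally smooth fields, so the constant coordinate
field is cut off by a bump function. By locality this does not change the covariant derivative where
the bump function is 1 nearby. -/
theorem contDiffOn [T2Space M] (hΨ : IsParametrization Ψ)
    (hcov : CovariantDerivative.ContMDiffCovariantDerivative cov ∞) :
    ContDiffOn ℝ ∞ Γ Ψ.source := by
  refine contDiffOn_clm_apply.2 fun v => contDiffOn_clm_apply.2 fun u => ?_
  intro z₀ hz₀
  refine ContDiffAt.contDiffWithinAt ?_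
  have hp := Ψ.map_source hz₀
  obtain ⟨f, -, hf⟩ := (SmoothBumpFunction.nhds_basis_tsupport (I := 𝓘(ℝ, E)) (Ψ z₀)).mem_iff.1
    (Ψ.open_target.mem_nhds hp)
  set X : ∀ p : M, TangentSpace 𝓘(ℝ, E) p := (f : M → ℝ) • field Ψ fun _ => v with hX
  have hXs : ContMDiff 𝓘(ℝ, E) 𝓘(ℝ, E).tangent ∞
      (fun p => (⟨p, X p⟩ : TangentBundle 𝓘(ℝ, E) M)) :=
    f.contMDiff.contMDiffOn.smul_section_of_tsupport Ψ.open_target hf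
      (hΨ.contMDiffOn_field contDiffOn_const)
  have h1 := hcov.contMDiff.contMDiff (σ := X) (by simpa using hXs.contMDiffOn)
  have h2 := ContMDiffAt.clm_bundle_apply (b := fun p : M => p)
    ((h1 (Ψ z₀) (mem_univ _)).contMDiffAt univ_mem)
    (hΨ.contMDiffAt_field hz₀ (contDiffAt_const (c := u)))
  have h3 := hΨ.contDiffAt_comps (X := fun p => cov X p (field Ψ (fun _ => u) p)) hz₀ h2
  refine h3.congr_of_eventuallyEq ?_
  have h4 : ∀ᶠ z in 𝓝 z₀, ∀ᶠ p in 𝓝 (Ψ z), f p = 1 :=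
    (Ψ.continuousAt hz₀).eventually f.eventuallyEq_one.eventually_nhds
  filter_upwards [h4, Ψ.open_source.mem_nhds hz₀] with z hz hzs
  have h5 := (hΨ.contMDiffAt_field hzs (contDiffAt_const (c := v))).mdifferentiableAt (by simp)
  have h6 : cov X (Ψ z) = cov (field Ψ fun _ => v) (Ψ z) := by
    refine cov.isCovariantDerivativeOnUniv.congr_of_eventuallyEq
      (hXs.contMDiffAt.mdifferentiableAt (by simp)) h5 univ_mem ?_
    filter_upwards [hz] with p hp
    simp [hX, hp]
  rw [comps, h6, hΨ.field_apply hzs, hΓ.comp_cov_field_const hΨ hzs]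

/-- Fields with constant components commute, so their torsion is the antisymmetric part of `Γ`. -/
theorem symm_of_torsion_eq_zero (hΨ : IsParametrization Ψ)
    (htorsion : haveI : IsManifold 𝓘(ℝ, E) 2 M := .of_le (n := ∞) two_le_infty
      cov.torsion = 0)
    {z : E} (hz : z ∈ Ψ.source) (u v : E) : Γ z u v = Γ z v u := by
  have : IsManifold 𝓘(ℝ, E) 2 M := .of_le (n := ∞) two_le_infty
  have hu := (hΨ.contMDiffAt_field hz (contDiffAt_const (c := u))).mdifferentiableAt
    (by simp)
  have hv := (hΨ.contMDiffAt_field hz (contDiffAt_const (c := v))).mdifferentiableAt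
    (by simp)
  have h := cov.torsion_eq_zero_iff.1 htorsion hu hv
  have hc : ∀ v : E, fderiv ℝ (comps Ψ (field Ψ fun _ => v)) z = 0 := fun v => by
    have : comps Ψ (field Ψ fun _ => v) =ᶠ[𝓝 z] fun _ => v :=
      eventually_of_mem (Ψ.open_source.mem_nhds hz) fun y hy => hΨ.comps_field hy _
    rw [this.fderiv_eq]
    simp
  have h2 := congrArg (comp Ψ (Ψ z)) h
  have h3 := hΨ.comps_mlieBracket hz hu hv
  rw [comps] at h3
  rw [h3, map_sub, hΨ.field_apply hz, hΨ.field_apply hz, hΓ.comp_cov_field_const hΨ hz,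
    hΓ.comp_cov_field_const hΨ hz, hc, hc] at h2
  simp only [zero_apply, sub_zero] at h2
  exact (sub_eq_zero.1 h2).symm

/-- In coordinates in which the Christoffel symbols vanish to first order at `z`, the curvature
vanishes at `z`. -/
theorem curvature_eq_zero (hΨ : IsParametrization Ψ)
    (hcov : CovariantDerivative.ContMDiffCovariantDerivative cov ∞)
    {z : E} (hz : z ∈ Ψ.source) (h0 : Γ z = 0)
    (h1 : HasFDerivAt Γ (0 : E →L[ℝ] E →L[ℝ] E →L[ℝ] E) z)
    {X Y Z : ∀ p : M, TangentSpace 𝓘(ℝ, E) p}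
    (hX : ContMDiff 𝓘(ℝ, E) 𝓘(ℝ, E).tangent ∞
      (fun p => (⟨p, X p⟩ : TangentBundle 𝓘(ℝ, E) M)))
    (hY : ContMDiff 𝓘(ℝ, E) 𝓘(ℝ, E).tangent ∞
      (fun p => (⟨p, Y p⟩ : TangentBundle 𝓘(ℝ, E) M)))
    (hZ : ContMDiff 𝓘(ℝ, E) 𝓘(ℝ, E).tangent ∞
      (fun p => (⟨p, Z p⟩ : TangentBundle 𝓘(ℝ, E) M))) :
    curvature cov X Y Z (Ψ z) = 0 := by
  have hZ1 := hcov.contMDiff.contMDiff (σ := Z) (by simpa using hZ.contMDiffOn)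
  have hd : ∀ {W : ∀ p : M, TangentSpace 𝓘(ℝ, E) p}, ContMDiff 𝓘(ℝ, E) 𝓘(ℝ, E).tangent ∞
      (fun p => (⟨p, W p⟩ : TangentBundle 𝓘(ℝ, E) M)) → ContDiffAt ℝ ∞ (comps Ψ W) z :=
    fun h => hΨ.contDiffAt_comps hz h.contMDiffAt
  have hd' : ∀ {W : ∀ p : M, TangentSpace 𝓘(ℝ, E) p}, ContMDiff 𝓘(ℝ, E) 𝓘(ℝ, E).tangent ∞
      (fun p => (⟨p, W p⟩ : TangentBundle 𝓘(ℝ, E) M)) → DifferentiableAt ℝ (comps Ψ W) z :=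
    fun h => (hd h).differentiableAt (by simp)
  have hpush : ∀ W : ∀ p : M, TangentSpace 𝓘(ℝ, E) p, ∀ y ∈ Ψ.source,
      W (Ψ y) = pushVec Ψ y (comps Ψ W y) := fun W y hy => (hΨ.pushVec_comp hy _).symm
  have hZ' : HasFDerivAt (fderiv ℝ (comps Ψ Z)) (fderiv ℝ (fderiv ℝ (comps Ψ Z)) z) z :=
    (((hd hZ).fderiv_right (m := ∞) le_rfl).differentiableAt (by simp)).hasFDerivAt
  have hsymm : IsSymmSndFDerivAt ℝ (comps Ψ Z) z :=
    (hd hZ).isSymmSndFDerivAt (by simpa using two_le_infty)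
  have second : ∀ {A B : ∀ p : M, TangentSpace 𝓘(ℝ, E) p}, ContMDiff 𝓘(ℝ, E) 𝓘(ℝ, E).tangent ∞
      (fun p => (⟨p, A p⟩ : TangentBundle 𝓘(ℝ, E) M)) →
      comp Ψ (Ψ z) (cov (fun q => cov Z q (A q)) (Ψ z) (B (Ψ z))) =
        fderiv ℝ (fderiv ℝ (comps Ψ Z)) z (comps Ψ B z) (comps Ψ A z) +
          fderiv ℝ (comps Ψ Z) z (fderiv ℝ (comps Ψ A) z (comps Ψ B z)) := by
    intro A B hA
    have hW : ContMDiff 𝓘(ℝ, E) 𝓘(ℝ, E).tangent ∞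
        (fun p => (⟨p, cov Z p (A p)⟩ : TangentBundle 𝓘(ℝ, E) M)) := fun p =>
      ContMDiffAt.clm_bundle_apply (b := fun p : M => p)
        ((hZ1 p (mem_univ _)).contMDiffAt univ_mem) (hA p)
    have hc : comps Ψ (fun q => cov Z q (A q)) =ᶠ[𝓝 z] fun y =>
        fderiv ℝ (comps Ψ Z) y (comps Ψ A y) + Γ y (comps Ψ Z y) (comps Ψ A y) := by
      filter_upwards [Ψ.open_source.mem_nhds hz] with y hy
      rw [← hΓ y hy Z (hZ.contMDiffAt.mdifferentiableAt (by simp)), ← hpush A y hy, comps]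
    have hD := (hZ'.clm_apply (hd' hA).hasFDerivAt).fun_add
      ((h1.clm_apply (hd' hZ).hasFDerivAt).clm_apply (hd' hA).hasFDerivAt)
    rw [hpush B z hz, hΓ z hz _ (hW.contMDiffAt.mdifferentiableAt (by simp)), hc.fderiv_eq,
      HasFDerivAt.fderiv hD, h0]
    simp [add_comm]
  apply hΨ.comp_injective (Ψ.map_source hz)
  have h3 := hΨ.comps_mlieBracket hz (hX.contMDiffAt.mdifferentiableAt (by simp))
    (hY.contMDiffAt.mdifferentiableAt (by simp))
  have h4 : comp Ψ (Ψ z) (cov Z (Ψ z) (mlieBracket 𝓘(ℝ, E) X Y (Ψ z))) =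
      fderiv ℝ (comps Ψ Z) z (fderiv ℝ (comps Ψ Y) z (comps Ψ X z)
        - fderiv ℝ (comps Ψ X) z (comps Ψ Y z)) := by
    rw [hpush (mlieBracket 𝓘(ℝ, E) X Y) z hz, hΓ z hz Z (hZ.contMDiffAt.mdifferentiableAt (by simp)), h3, h0]
    simp
  -- Antisymmetrizing `second` kills the second derivative of `Z` by its symmetry, and what remains
  -- is the derivative of `Z` along the bracket.
  rw [curvature, map_sub, map_sub, second hY, second hX, h4, map_zero, map_sub,
    hsymm.eq (comps Ψ X z) (comps Ψ Y z)]
  abel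

end IsChristoffel

end GeodesicLoop

/-! ### Covariant derivative along a curve in coordinates -/

namespace GeodesicLoop

open Filter Topology

variable {E : Type*} [NormedAddCommGroup E] [NormedSpace ℝ E]
  {M : Type*} [TopologicalSpace M] [ChartedSpace E M]
  {Ψ : OpenPartialHomeomorph E M}

theorem IsParametrization.mdifferentiableAt_curve (hΨ : IsParametrization Ψ) {γ : ℝ → M} {t : ℝ}
    (hγ : ContinuousAt γ t) (ht : γ t ∈ Ψ.target)
    (hc : DifferentiableAt ℝ (fun s => Ψ.symm (γ s)) t) :
    MDifferentiableAt 𝓘(ℝ, ℝ) 𝓘(ℝ, E) γ t := by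
  have h1 : MDifferentiableAt 𝓘(ℝ, ℝ) 𝓘(ℝ, E) (fun s => Ψ (Ψ.symm (γ s))) t :=
    (hΨ.mdifferentiable.mdifferentiableAt (Ψ.map_target ht)).comp t hc.mdifferentiableAt
  refine h1.congr_of_eventuallyEq ?_
  filter_upwards [hγ.preimage_mem_nhds (Ψ.open_target.mem_nhds ht)] with s hs
  exact (Ψ.right_inv hs).symm

theorem IsParametrization.comp_velocity_of_mdifferentiableAt (hΨ : IsParametrization Ψ)
    {γ : ℝ → M} {t : ℝ} (hγ : MDifferentiableAt 𝓘(ℝ, ℝ) 𝓘(ℝ, E) γ t) (ht : γ t ∈ Ψ.target) :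
    HasDerivAt (fun s => Ψ.symm (γ s)) (comp Ψ (γ t) (velocity γ t)) t := by
  have h2 := mfderiv_comp t (hΨ.mdifferentiable.mdifferentiableAt_symm ht) hγ
  have h4 : DifferentiableAt ℝ (fun s => Ψ.symm (γ s)) t :=
    ((hΨ.mdifferentiable.mdifferentiableAt_symm ht).comp t hγ).differentiableAt
  rw [mfderiv_eq_fderiv] at h2
  have h3 : fderiv ℝ (fun s => Ψ.symm (γ s)) t 1 = comp Ψ (γ t) (velocity γ t) :=
    congrArg (fun L => L 1) h2
  rw [← h3]
  exact h4.hasDerivAt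

theorem IsParametrization.comp_velocity (hΨ : IsParametrization Ψ)
    {γ : ℝ → M} {t : ℝ} {c' : E}
    (hγ : ContinuousAt γ t) (ht : γ t ∈ Ψ.target) (hc : HasDerivAt (fun s => Ψ.symm (γ s)) c' t) :
    comp Ψ (γ t) (velocity γ t) = c' :=
  (hΨ.comp_velocity_of_mdifferentiableAt
    (hΨ.mdifferentiableAt_curve hγ ht hc.differentiableAt) ht).unique hc

variable [FiniteDimensional ℝ E] [IsManifold 𝓘(ℝ, E) ∞ M]
  {cov : CovariantDerivative 𝓘(ℝ, E) E (TangentSpace 𝓘(ℝ, E) : M → Type _)}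
  {Γ : E → E →L[ℝ] E →L[ℝ] E}

omit [FiniteDimensional ℝ E] in
theorem IsChristoffel.comp_cov (hΓ : IsChristoffel cov Ψ Γ) (hΨ : IsParametrization Ψ)
    {p : M} (hp : p ∈ Ψ.target) {X : ∀ p : M, TangentSpace 𝓘(ℝ, E) p}
    (hX : MDifferentiableAt 𝓘(ℝ, E) 𝓘(ℝ, E).tangent
      (fun p => (⟨p, X p⟩ : TangentBundle 𝓘(ℝ, E) M)) p) (ξ : TangentSpace 𝓘(ℝ, E) p) :
    comp Ψ p (cov X p ξ) = fderiv ℝ (comps Ψ X) (Ψ.symm p) (comp Ψ p ξ) +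
      Γ (Ψ.symm p) (comp Ψ p (X p)) (comp Ψ p ξ) := by
  obtain ⟨z, hz, rfl⟩ : ∃ z ∈ Ψ.source, Ψ z = p := ⟨Ψ.symm p, Ψ.map_target hp, Ψ.right_inv hp⟩
  rw [Ψ.left_inv hz]
  conv_lhs => rw [← hΨ.pushVec_comp hz ξ]
  exact hΓ z hz X hX _

omit [FiniteDimensional ℝ E] in
/-- The derivative of a chart read in the parametrization, in terms of the trivialization. -/
theorem IsParametrization.fderiv_extChartAt (hΨ : IsParametrization Ψ) (p₀ : M) {p : M}
    (hp : p ∈ Ψ.target) (hp₀ : p ∈ (chartAt E p₀).source) (ξ : TangentSpace 𝓘(ℝ, E) p) :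
    fderiv ℝ (fun z => extChartAt 𝓘(ℝ, E) p₀ (Ψ z)) (Ψ.symm p) (comp Ψ p ξ) =
      (trivializationAt E (TangentSpace 𝓘(ℝ, E) : M → Type _) p₀
        (⟨p, ξ⟩ : TangentBundle 𝓘(ℝ, E) M)).2 := by
  have : IsManifold 𝓘(ℝ, E) 1 M := .of_le (n := ∞) (by simp)
  obtain ⟨z, hz, rfl⟩ : ∃ z ∈ Ψ.source, Ψ z = p := ⟨Ψ.symm p, Ψ.map_target hp, Ψ.right_inv hp⟩
  rw [Ψ.left_inv hz]
  have h1 := TangentBundle.continuousLinearMapAt_trivializationAt (I := 𝓘(ℝ, E)) hp₀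
  have h2 := mfderiv_comp z (mdifferentiableAt_extChartAt (I := 𝓘(ℝ, E)) hp₀)
    (hΨ.mdifferentiable.mdifferentiableAt hz)
  rw [mfderiv_eq_fderiv] at h2
  have h3 : fderiv ℝ (fun z => extChartAt 𝓘(ℝ, E) p₀ (Ψ z)) z (comp Ψ (Ψ z) ξ) =
      mfderiv 𝓘(ℝ, E) 𝓘(ℝ, E) (extChartAt 𝓘(ℝ, E) p₀) (Ψ z)
        (pushVec Ψ z (comp Ψ (Ψ z) ξ)) := congrArg (fun L => L (comp Ψ (Ψ z) ξ)) h2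
  have h4 : (trivializationAt E (TangentSpace 𝓘(ℝ, E) : M → Type _) p₀).continuousLinearMapAt ℝ
      (Ψ z) ξ = (trivializationAt E (TangentSpace 𝓘(ℝ, E) : M → Type _) p₀
        (⟨Ψ z, ξ⟩ : TangentBundle 𝓘(ℝ, E) M)).2 := by
    rw [Trivialization.continuousLinearMapAt_apply, Trivialization.linearMapAt_apply, if_pos]
    exact hp₀
  rw [h3, hΨ.pushVec_comp hz]
  exact (congrArg (fun L => L ξ) h1).symm.trans h4

/-- The covariant derivative along a curve in coordinates. -/
theorem IsChristoffel.comp_covDerivAlong (hΓ : IsChristoffel cov Ψ Γ) (hΨ : IsParametrization Ψ)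
    {γ : ℝ → M} {V : ∀ t : ℝ, TangentSpace 𝓘(ℝ, E) (γ t)} {t : ℝ} {c' w' : E}
    (hγ : ContinuousAt γ t) (ht : γ t ∈ Ψ.target)
    (hc : HasDerivAt (fun s => Ψ.symm (γ s)) c' t)
    (hw : HasDerivAt (fun s => comp Ψ (γ s) (V s)) w' t) :
    comp Ψ (γ t) (covDerivAlong cov γ V t) =
      w' + Γ (Ψ.symm (γ t)) (comp Ψ (γ t) (V t)) c' := by
  have : IsManifold 𝓘(ℝ, E) 1 M := .of_le (n := ∞) (by simp)
  set p₀ := γ t with hp₀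
  set z₀ := Ψ.symm p₀ with hz₀
  have hzs : z₀ ∈ Ψ.source := Ψ.map_target ht
  have hΨz : Ψ z₀ = p₀ := Ψ.right_inv ht
  -- `covDerivAlong` is defined through the chart at `γ t`. Its trivialization, in the components of
  -- `Ψ`, is the derivative of the coordinate change `G`, so the claim is tested after applying that
  -- injective derivative.
  set G : E → E := fun z => extChartAt 𝓘(ℝ, E) p₀ (Ψ z) with hG
  have hGs : ContDiffAt ℝ ∞ G z₀ := by
    have h1 : ContMDiffAt 𝓘(ℝ, E) 𝓘(ℝ, E) ∞ (extChartAt 𝓘(ℝ, E) p₀) (Ψ z₀) := by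
      rw [hΨz]; exact contMDiffAt_extChartAt
    exact (h1.comp z₀ (hΨ.contMDiffAt hzs)).contDiffAt
  have hD : HasFDerivAt (fderiv ℝ G) (fderiv ℝ (fderiv ℝ G) z₀) z₀ :=
    ((hGs.fderiv_right (m := ∞) le_rfl).differentiableAt (by simp)).hasFDerivAt
  set T := trivializationAt E (TangentSpace 𝓘(ℝ, E) : M → Type _) p₀ with hT
  have hbase : ∀ᶠ p in 𝓝 p₀, p ∈ Ψ.target ∧ p ∈ (chartAt E p₀).source :=
    Filter.inter_mem (Ψ.open_target.mem_nhds ht) (chart_source_mem_nhds E p₀)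
  have hp₀s : p₀ ∈ (chartAt E p₀).source := mem_chart_source E p₀
  have hGT : ∀ p ∈ Ψ.target, p ∈ (chartAt E p₀).source → ∀ ξ : TangentSpace 𝓘(ℝ, E) p,
      fderiv ℝ G (Ψ.symm p) (comp Ψ p ξ) = (T (⟨p, ξ⟩ : TangentBundle 𝓘(ℝ, E) M)).2 :=
    fun p hp hp' ξ => hΨ.fderiv_extChartAt p₀ hp hp' ξ
  have hsymm : ∀ p ∈ (chartAt E p₀).source, ∀ k : E,
      (T (⟨p, T.symm p k⟩ : TangentBundle 𝓘(ℝ, E) M)).2 = k := fun p hp k => by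
    rw [T.apply_mk_symm (show p ∈ T.baseSet from hp)]
  have hinj : Function.Injective (fderiv ℝ G z₀) := by
    refine (injective_iff_map_eq_zero _).2 fun v hv => ?_
    obtain ⟨ξ, rfl⟩ := hΨ.mdifferentiable.symm.mfderiv_surjective ht v
    have h1 := hGT p₀ ht hp₀s ξ
    have h2 : (T (⟨p₀, ξ⟩ : TangentBundle 𝓘(ℝ, E) M)).2 = 0 := h1.symm.trans hv
    have h3 : ξ = 0 := by
      have h4 := T.symm_apply_apply_mk (show p₀ ∈ T.baseSet from hp₀s) ξ
      rw [h2] at h4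
      rw [← h4]
      have h5 := (T.symmL ℝ p₀).map_zero
      rw [Trivialization.symmL_apply] at h5
      · exact h5
      · exact hp₀s
    rw [h3]
    exact map_zero _
  apply hinj
  -- the curve term
  have hA : HasDerivAt (fun s => (T (⟨γ s, V s⟩ : TangentBundle 𝓘(ℝ, E) M)).2)
      (fderiv ℝ (fderiv ℝ G) z₀ c' (comp Ψ p₀ (V t)) + fderiv ℝ G z₀ w') t := by
    have h0 : HasDerivAt (fun s => fderiv ℝ G (Ψ.symm (γ s))) (fderiv ℝ (fderiv ℝ G) z₀ c') t :=
      HasFDerivAt.comp_hasDerivAt t hD hc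
    have h1 := h0.clm_apply hw
    refine h1.congr_of_eventuallyEq ?_
    filter_upwards [hγ.eventually hbase] with s hs
    exact (hGT _ hs.1 hs.2 _).symm
  -- the extension term
  set X := FiberBundle.extend E (V t) with hX
  have hXd : MDifferentiableAt 𝓘(ℝ, E) 𝓘(ℝ, E).tangent
      (fun p => (⟨p, X p⟩ : TangentBundle 𝓘(ℝ, E) M)) p₀ := FiberBundle.mdifferentiableAt_extend ..
  have hXp : X p₀ = V t := FiberBundle.extend_apply_self _ _
  have hXc : comps Ψ X z₀ = comp Ψ p₀ (V t) := by
    rw [← hXp, comps, hΨz]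
  have hB : fderiv ℝ (fderiv ℝ G) z₀ c' (comp Ψ p₀ (V t)) +
      fderiv ℝ G z₀ (fderiv ℝ (comps Ψ X) z₀ c') = 0 := by
    have h1 := hD.clm_apply (hΨ.differentiableAt_comps hzs (by rwa [hΨz])).hasFDerivAt
    have h2 : (fun z => fderiv ℝ G z (comps Ψ X z)) =ᶠ[𝓝 z₀]
        fun _ => (T (⟨p₀, V t⟩ : TangentBundle 𝓘(ℝ, E) M)).2 := by
      have h5 := (Ψ.continuousAt hzs)
      rw [ContinuousAt, hΨz] at h5
      filter_upwards [h5.eventually hbase, Ψ.open_source.mem_nhds hzs] with z hz hz'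
      have h6 := hGT _ hz.1 hz.2 (X (Ψ z))
      rw [Ψ.left_inv hz'] at h6
      refine h6.trans ?_
      exact hsymm _ hz.2 _
    have h3 := (hasFDerivAt_const _ z₀).congr_of_eventuallyEq h2 |>.unique h1
    have h4 := congrArg (fun L => L c') h3
    simp only [hXc] at h4
    rw [add_comm]
    exact h4.symm
  have hC := hΓ.comp_cov hΨ ht hXd (velocity γ t)
  rw [hΨ.comp_velocity hγ ht hc, hXp] at hC
  -- The second derivative of `G` enters once from the curve term and once, through `hB`, from the
  -- extension, whose trivialized value is locally constant. The two contributions cancel.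
  rw [covDerivAlong, map_add, hC, hA.deriv, map_add, map_add, map_add,
    hGT p₀ ht hp₀s, hsymm p₀ hp₀s, add_add_add_comm, hB, zero_add]

end GeodesicLoop

/-! ### Geodesics and parallel fields as solutions of ordinary differential equations -/

namespace GeodesicLoop

open Filter Topology

variable {E : Type*} [NormedAddCommGroup E] [NormedSpace ℝ E]

/-- `c` solves the geodesic equation with coefficients `Γ` on `J`, stays in `U`, and has
velocity `u`. -/
structure IsGeodesicSol (Γ : E → E →L[ℝ] E →L[ℝ] E) (U : Set E) (c u : ℝ → E) (J : Set ℝ) :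
    Prop where
  mem : ∀ t ∈ J, c t ∈ U
  hasDerivAt : ∀ t ∈ J, HasDerivAt c (u t) t
  hasDerivAt_velocity : ∀ t ∈ J, HasDerivAt u (-Γ (c t) (u t) (u t)) t

variable {M : Type*} [TopologicalSpace M] [ChartedSpace E M]
  {Ψ : OpenPartialHomeomorph E M}

theorem IsParametrization.contMDiffOn_pushVec [IsManifold 𝓘(ℝ, E) ∞ M]
    (hΨ : IsParametrization Ψ) {J : Set ℝ} {c w : ℝ → E}
    (hc : ContDiffOn ℝ ∞ c J) (hw : ContDiffOn ℝ ∞ w J) (hm : MapsTo c J Ψ.source) :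
    ContMDiffOn 𝓘(ℝ, ℝ) 𝓘(ℝ, E).tangent ∞
      (fun t => (⟨Ψ (c t), pushVec Ψ (c t) (w t)⟩ : TangentBundle 𝓘(ℝ, E) M)) J := by
  have h1 : ContMDiffOn 𝓘(ℝ, ℝ) 𝓘(ℝ, E).tangent ∞
      (fun t => (⟨c t, w t⟩ : TangentBundle 𝓘(ℝ, E) E)) J := by
    intro t ht
    rw [contMDiffWithinAt_totalSpace]
    refine ⟨hc.contMDiffOn t ht, ?_⟩
    simp only [trivializationAt_model_space_apply]
    exact hw.contMDiffOn t ht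
  have h2 := (hΨ.smooth.contMDiffOn_tangentMapWithin (m := ∞) le_rfl
    Ψ.open_source.uniqueMDiffOn).comp h1 hm
  refine h2.congr fun t ht => ?_
  simp only [Function.comp, tangentMapWithin]
  rw [mfderivWithin_of_isOpen Ψ.open_source (hm ht)]
  rfl

variable [FiniteDimensional ℝ E] [IsManifold 𝓘(ℝ, E) ∞ M]
  {cov : CovariantDerivative 𝓘(ℝ, E) E (TangentSpace 𝓘(ℝ, E) : M → Type _)}
  {Γ : E → E →L[ℝ] E →L[ℝ] E} {c u w : ℝ → E} {J : Set ℝ}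

omit [ChartedSpace E M] [FiniteDimensional ℝ E] [IsManifold 𝓘(ℝ, E) ∞ M] in
theorem IsGeodesicSol.symm_eventuallyEq (h : IsGeodesicSol Γ Ψ.source c u J) {t : ℝ}
    (ht : t ∈ J) : (fun s => Ψ.symm (Ψ (c s))) =ᶠ[𝓝 t] c := by
  filter_upwards [(h.hasDerivAt t ht).continuousAt.preimage_mem_nhds
    (Ψ.open_source.mem_nhds (h.mem t ht))] with s hs
  exact Ψ.left_inv hs

omit [ChartedSpace E M] [FiniteDimensional ℝ E] [IsManifold 𝓘(ℝ, E) ∞ M] in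
theorem IsGeodesicSol.continuousAt (h : IsGeodesicSol Γ Ψ.source c u J) {t : ℝ}
    (ht : t ∈ J) : ContinuousAt (fun s => Ψ (c s)) t :=
  (Ψ.continuousAt (h.mem t ht)).comp (h.hasDerivAt t ht).continuousAt

omit [ChartedSpace E M] [FiniteDimensional ℝ E] [IsManifold 𝓘(ℝ, E) ∞ M] in
theorem IsGeodesicSol.hasDerivAt_symm (h : IsGeodesicSol Γ Ψ.source c u J) {t : ℝ}
    (ht : t ∈ J) : HasDerivAt (fun s => Ψ.symm (Ψ (c s))) (u t) t :=
  (h.hasDerivAt t ht).congr_of_eventuallyEq (h.symm_eventuallyEq ht)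

omit [FiniteDimensional ℝ E] [IsManifold 𝓘(ℝ, E) ∞ M] in
theorem IsGeodesicSol.velocity_eq (h : IsGeodesicSol Γ Ψ.source c u J) (hΨ : IsParametrization Ψ)
    {t : ℝ} (ht : t ∈ J) : velocity (fun s => Ψ (c s)) t = pushVec Ψ (c t) (u t) := by
  have hp := Ψ.map_source (h.mem t ht)
  apply hΨ.comp_injective hp
  rw [hΨ.comp_pushVec (h.mem t ht)]
  exact hΨ.comp_velocity (h.continuousAt ht) hp (h.hasDerivAt_symm ht)

theorem IsGeodesicSol.covDerivAlong_eq (h : IsGeodesicSol Γ Ψ.source c u J)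
    (hΓ : IsChristoffel cov Ψ Γ) (hΨ : IsParametrization Ψ)
    {V : ∀ t : ℝ, TangentSpace 𝓘(ℝ, E) (Ψ (c t))} {w' : E} {t : ℝ}
    (hJ : J ∈ 𝓝 t) (hV : ∀ s ∈ J, V s = pushVec Ψ (c s) (w s)) (hw : HasDerivAt w w' t) :
    comp Ψ (Ψ (c t)) (covDerivAlong cov (fun s => Ψ (c s)) V t) =
      w' + Γ (c t) (w t) (u t) := by
  have ht := mem_of_mem_nhds hJ
  have hs := h.mem t ht
  have hp := Ψ.map_source hs
  have h1 : (fun s => comp Ψ (Ψ (c s)) (V s)) =ᶠ[𝓝 t] w := by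
    filter_upwards [hJ] with s hs
    rw [hV s hs, hΨ.comp_pushVec (h.mem s hs)]
  have h2 := hΓ.comp_covDerivAlong hΨ (γ := fun s => Ψ (c s)) (V := V) (t := t)
    (h.continuousAt ht) hp (h.hasDerivAt_symm ht) (hw.congr_of_eventuallyEq h1)
  rw [h2, Ψ.left_inv hs, hV t ht, hΨ.comp_pushVec hs]

/-- Solutions of the geodesic equation in coordinates are geodesics. -/
theorem IsGeodesicSol.isGeodesicOn (h : IsGeodesicSol Γ Ψ.source c u J)
    (hΓ : IsChristoffel cov Ψ Γ) (hΨ : IsParametrization Ψ) (hJ : IsOpen J)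
    (hc : ContDiffOn ℝ ∞ c J) : IsGeodesicOn cov (fun t => Ψ (c t)) J where
  smooth := hΨ.smooth.comp hc.contMDiffOn h.mem
  geodesic t ht := by
    apply hΨ.comp_injective (Ψ.map_source (h.mem t ht))
    rw [map_zero, h.covDerivAlong_eq hΓ hΨ (hJ.mem_nhds ht) (fun s hs => h.velocity_eq hΨ hs)
      (h.hasDerivAt_velocity t ht), neg_add_cancel]

/-- Solutions of the equation of parallel transport in coordinates are parallel. -/
theorem IsGeodesicSol.isParallelOn (h : IsGeodesicSol Γ Ψ.source c u J)
    (hΓ : IsChristoffel cov Ψ Γ) (hΨ : IsParametrization Ψ) (hJ : IsOpen J)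
    (hc : ContDiffOn ℝ ∞ c J) (hw : ContDiffOn ℝ ∞ w J)
    (hw' : ∀ t ∈ J, HasDerivAt w (-Γ (c t) (w t) (u t)) t) :
    IsParallelOn cov (fun t => Ψ (c t)) (fun t => pushVec Ψ (c t) (w t)) J where
  smooth := hΨ.contMDiffOn_pushVec hc hw h.mem
  parallel t ht := by
    apply hΨ.comp_injective (Ψ.map_source (h.mem t ht))
    rw [map_zero, h.covDerivAlong_eq hΓ hΨ (hJ.mem_nhds ht) (fun s hs => rfl)
      (hw' t ht), neg_add_cancel]

/-- Geodesics solve the geodesic equation in coordinates. -/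
theorem IsGeodesicOn.hasDerivAt_comp {γ : ℝ → M} (hγ : IsGeodesicOn cov γ J) (hJ : IsOpen J)
    (hΓ : IsChristoffel cov Ψ Γ) (hΨ : IsParametrization Ψ) {t : ℝ} (ht : t ∈ J)
    (hp : γ t ∈ Ψ.target) :
    HasDerivAt (fun s => Ψ.symm (γ s)) (comp Ψ (γ t) (velocity γ t)) t ∧
    HasDerivAt (fun s => comp Ψ (γ s) (velocity γ s))
      (-Γ (Ψ.symm (γ t)) (comp Ψ (γ t) (velocity γ t)) (comp Ψ (γ t) (velocity γ t))) t := by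
  have hsm : ∀ s ∈ J, ContMDiffAt 𝓘(ℝ, ℝ) 𝓘(ℝ, E) ∞ γ s := fun s hs =>
    hγ.smooth.contMDiffAt (hJ.mem_nhds hs)
  have hd : ∀ s ∈ J, γ s ∈ Ψ.target →
      HasDerivAt (fun s => Ψ.symm (γ s)) (comp Ψ (γ s) (velocity γ s)) s := fun s hs hp =>
    hΨ.comp_velocity_of_mdifferentiableAt ((hsm s hs).mdifferentiableAt (by simp)) hp
  refine ⟨hd t ht hp, ?_⟩
  have hcont := (hsm t ht).continuousAt
  have h1 : (fun s => comp Ψ (γ s) (velocity γ s)) =ᶠ[𝓝 t] deriv fun s => Ψ.symm (γ s) := by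
    filter_upwards [hJ.mem_nhds ht, hcont.preimage_mem_nhds (Ψ.open_target.mem_nhds hp)]
      with s hs hs'
    exact (hd s hs hs').deriv.symm
  have h2 : ContDiffAt ℝ ∞ (fun s => Ψ.symm (γ s)) t :=
    ((hΨ.contMDiffAt_symm hp).comp t (hsm t ht)).contDiffAt
  have h3 : DifferentiableAt ℝ (deriv fun s => Ψ.symm (γ s)) t := by
    have h4 : ContDiffAt ℝ 1 (fun s => fderiv ℝ (fun s => Ψ.symm (γ s)) s 1) t :=
      (h2.fderiv_right (m := 1) two_le_infty).clm_apply contDiffAt_const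
    exact h4.differentiableAt one_ne_zero
  have h4 := h3.hasDerivAt.congr_of_eventuallyEq h1
  have h5 := hΓ.comp_covDerivAlong hΨ hcont hp (hd t ht hp) h4
  rw [hγ.geodesic t ht, map_zero] at h5
  rw [← eq_neg_of_add_eq_zero_left h5.symm]
  exact h4

/-- Uniqueness of the exponential map: it is computed by any solution in coordinates. -/
theorem IsExp.eq_of_isGeodesicSol [T2Space M] {ξ : TangentBundle 𝓘(ℝ, E) M} {q : M}
    (hq : IsExp cov ξ q)
    (h : IsGeodesicSol Γ Ψ.source c u J) (hΓ : IsChristoffel cov Ψ Γ) (hΨ : IsParametrization Ψ)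
    (hΓs : ContDiffOn ℝ ∞ Γ Ψ.source) (hJ : IsOpen J) (hJ' : Icc 0 1 ⊆ J)
    (hξ : ξ = ⟨Ψ (c 0), pushVec Ψ (c 0) (u 0)⟩) : q = Ψ (c 1) := by
  obtain ⟨I, γ, hI, hI', hγ, h0, rfl⟩ := hq
  set v : ℝ → E := fun s => comp Ψ (γ s) (velocity γ s) with hv
  -- `γ` is not known to remain in `Ψ.target`, so uniqueness is propagated along `[0, 1]`. The set
  -- is closed because `M` is Hausdorff, and agreement extends forward by local uniqueness.
  -- Velocities are included because the equation is first order only in phase space.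
  set S : Set ℝ := {t | γ t = Ψ (c t) ∧ v t = u t} with hS
  suffices hsub : Icc 0 1 ⊆ S from (hsub (right_mem_Icc.2 zero_le_one)).1
  have hcont : ∀ t ∈ I, ContinuousAt γ t := fun t ht =>
    (hγ.smooth.contMDiffAt (hI.mem_nhds ht)).continuousAt
  refine IsClosed.Icc_subset_of_forall_mem_nhdsWithin ?_ ?_ ?_
  · refine isClosed_of_closure_subset fun t ht => ?_
    have htI : t ∈ Icc (0 : ℝ) 1 := by
      simpa using closure_mono inter_subset_right ht
    rw [mem_closure_iff_frequently] at ht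
    have h1 : γ t = Ψ (c t) := tendsto_nhds_unique_of_frequently_eq (hcont t (hI' htI))
      (h.continuousAt (hJ' htI)) (ht.mono fun s hs => hs.1.1)
    have hp : γ t ∈ Ψ.target := h1 ▸ Ψ.map_source (h.mem t (hJ' htI))
    have h2 : v t = u t := tendsto_nhds_unique_of_frequently_eq
      (hγ.hasDerivAt_comp hI hΓ hΨ (hI' htI) hp).2.continuousAt
      (h.hasDerivAt_velocity t (hJ' htI)).continuousAt (ht.mono fun s hs => hs.1.2)
    exact ⟨⟨h1, h2⟩, htI⟩
  · have h1 := h0.trans hξ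
    have h2 : γ 0 = Ψ (c 0) := congrArg (fun ξ : TangentBundle 𝓘(ℝ, E) M => ξ.1) h1
    have h3 := congrArg (fun ξ : TangentBundle 𝓘(ℝ, E) M => comp Ψ ξ.1 ξ.2) h1
    exact ⟨h2, h3.trans (hΨ.comp_pushVec (h.mem 0 (hJ' (left_mem_Icc.2 zero_le_one))) _)⟩
  · rintro t ⟨⟨h1, h2⟩, ht⟩
    refine nhdsWithin_le_nhds ?_
    have htI := Ico_subset_Icc_self ht
    have hs := h.mem t (hJ' htI)
    have hp : γ t ∈ Ψ.target := h1 ▸ Ψ.map_source hs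
    have hF : ContDiffAt ℝ 1 (fun x : E × E => (x.2, -Γ x.1 x.2 x.2)) (c t, u t) := by
      have hΓ1 : ContDiffAt ℝ 1 (fun x : E × E => Γ x.1) (c t, u t) :=
        ((hΓs.contDiffAt (Ψ.open_source.mem_nhds hs)).of_le (by simp)).comp (c t, u t)
          contDiffAt_fst
      exact contDiffAt_snd.prodMk ((hΓ1.clm_apply contDiffAt_snd).clm_apply contDiffAt_snd).neg
    obtain ⟨K, s, hsn, hK⟩ := hF.exists_lipschitzOnWith
    have hg0 : (Ψ.symm (γ t), v t) = (c t, u t) := by rw [h1, Ψ.left_inv hs, h2]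
    have e1 : ∀ᶠ r in 𝓝 t, HasDerivAt (fun r => (Ψ.symm (γ r), v r))
        ((fun x : E × E => (x.2, -Γ x.1 x.2 x.2)) (Ψ.symm (γ r), v r)) r ∧
        (Ψ.symm (γ r), v r) ∈ s := by
      have hco : ContinuousAt (fun r => (Ψ.symm (γ r), v r)) t := by
        have := hγ.hasDerivAt_comp hI hΓ hΨ (hI' htI) hp
        exact this.1.continuousAt.prodMk this.2.continuousAt
      filter_upwards [hI.mem_nhds (hI' htI),
        (hcont t (hI' htI)).preimage_mem_nhds (Ψ.open_target.mem_nhds hp),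
        hco.preimage_mem_nhds (by rw [hg0]; exact hsn)] with r hr hr' hr''
      have := hγ.hasDerivAt_comp hI hΓ hΨ hr hr'
      exact ⟨this.1.prodMk this.2, hr''⟩
    have e2 : ∀ᶠ r in 𝓝 t, HasDerivAt (fun r => (c r, u r))
        ((fun x : E × E => (x.2, -Γ x.1 x.2 x.2)) (c r, u r)) r ∧ (c r, u r) ∈ s := by
      have hco : ContinuousAt (fun r => (c r, u r)) t :=
        (h.hasDerivAt t (hJ' htI)).continuousAt.prodMk
          (h.hasDerivAt_velocity t (hJ' htI)).continuousAt
      filter_upwards [hJ.mem_nhds (hJ' htI), hco.preimage_mem_nhds hsn] with r hr hr'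
      exact ⟨(h.hasDerivAt r hr).prodMk (h.hasDerivAt_velocity r hr), hr'⟩
    have e3 := ODE_solution_unique_of_eventually
      (v := fun _ => fun x : E × E => (x.2, -Γ x.1 x.2 x.2)) (s := fun _ => s)
      (Eventually.of_forall fun _ => hK) e1 e2 hg0
    filter_upwards [e3, (hcont t (hI' htI)).preimage_mem_nhds (Ψ.open_target.mem_nhds hp)]
      with r hr hr'
    obtain ⟨hr1, hr2⟩ := Prod.ext_iff.1 hr
    refine ⟨?_, hr2⟩
    rw [← Ψ.right_inv hr']
    exact congrArg Ψ hr1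

end GeodesicLoop

/-! ### Third order expansions of transport and geodesics -/

namespace GeodesicLoop

open Filter Topology

variable {E : Type*} [NormedAddCommGroup E] [NormedSpace ℝ E]
  {Γ : E → E →L[ℝ] E →L[ℝ] E}

theorem exists_norm_sub_fderiv_le {F : Type*} [NormedAddCommGroup F] [NormedSpace ℝ F]
    {f : E → F} {f' : E →L[ℝ] F} (h : HasFDerivAt f f' 0) (h0 : f 0 = 0) {ρ : ℝ} (hρ : 0 < ρ) :
    ∃ δ > 0, ∀ x, ‖x‖ < δ → ‖f x - f' x‖ ≤ ρ * ‖x‖ := by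
  obtain ⟨δ, hδ, H⟩ := Metric.eventually_nhds_iff_ball.1
    ((hasFDerivAt_iff_isLittleO_nhds_zero.1 h).bound hρ)
  refine ⟨δ, hδ, fun x hx => ?_⟩
  simpa [h0] using H x (by simpa using hx)

/-- The expansion of parallel transport to third order, for small geodesics. -/
theorem parallel_expansion (h0 : Γ 0 = 0) {A : E →L[ℝ] E →L[ℝ] E →L[ℝ] E}
    (hA : HasFDerivAt Γ A 0) {C : ℝ} (hC : 0 ≤ C) {ρ : ℝ} (hρ : 0 < ρ) :
    ∃ δ > 0, ∀ N, 0 ≤ N → N ≤ δ → ∀ z u w : ℝ → E,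
      (∀ t ∈ Icc (0 : ℝ) 1, HasDerivAt z (u t) t) →
      (∀ t ∈ Icc (0 : ℝ) 1, HasDerivAt u (-Γ (z t) (u t) (u t)) t) →
      (∀ t ∈ Icc (0 : ℝ) 1, HasDerivAt w (-Γ (z t) (w t) (u t)) t) →
      (∀ t ∈ Icc (0 : ℝ) 1, ‖z t‖ ≤ C * N ∧ ‖u t‖ ≤ C * N ∧ ‖w t‖ ≤ C * N) →
      ∀ t ∈ Icc (0 : ℝ) 1,
        ‖w t - (w 0 - t • A (z 0) (w 0) (u 0) - (t ^ 2 / 2) • A (u 0) (w 0) (u 0))‖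
          ≤ ρ * N ^ 3 := by
  -- Half of the error budget pays for replacing `Γ` by its linear part; the `+ 1` covers `C = 0`.
  set ρ₁ : ℝ := ρ / (2 * (C ^ 3 + 1)) with hρ₁
  have hρ₁0 : 0 < ρ₁ := by positivity
  have hρ₁C : ρ₁ * C ^ 3 ≤ ρ / 2 := by
    rw [hρ₁, div_mul_eq_mul_div, div_le_div_iff₀ (by positivity) (by positivity)]
    nlinarith [pow_nonneg hC 3]
  obtain ⟨δ₁, hδ₁, hball⟩ := exists_norm_sub_fderiv_le hA h0 hρ₁0
  set a := ‖A‖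
  have ha0 : 0 ≤ a := norm_nonneg _
  have hAa : ∀ x, ‖A x‖ ≤ a * ‖x‖ := A.le_opNorm
  set k := a + ρ₁ with hk
  have hk0 : 0 ≤ k := by positivity
  -- The total of the fifth order errors `b2`, `b3`, `b4` below, which contribute 1, 2 and 2.
  set B := 5 * a * k * C ^ 5 with hB
  have hB0 : 0 ≤ B := by positivity
  refine ⟨min 1 (min (δ₁ / (2 * (C + 1))) (ρ / (2 * (B + 1)))), by positivity, ?_⟩
  intro N hN hNδ z u w hz hu hw hb
  have hN1 : N ≤ 1 := hNδ.trans (min_le_left _ _)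
  have hNδ₁ : C * N < δ₁ := by
    have : N ≤ δ₁ / (2 * (C + 1)) := hNδ.trans ((min_le_right _ _).trans (min_le_left _ _))
    rw [le_div_iff₀ (by positivity)] at this
    nlinarith
  have hNB : B * N ^ 5 ≤ ρ / 2 * N ^ 3 := by
    have h1 : N ≤ ρ / (2 * (B + 1)) := hNδ.trans ((min_le_right _ _).trans (min_le_right _ _))
    rw [le_div_iff₀ (by positivity)] at h1
    have h2 : B * N ≤ ρ / 2 := by nlinarith
    have h3 : B * N ^ 2 ≤ B * N := by nlinarith [mul_nonneg hB0 hN]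
    have h4 : 0 ≤ N ^ 3 := by positivity
    calc B * N ^ 5 = B * N ^ 2 * N ^ 3 := by ring
      _ ≤ ρ / 2 * N ^ 3 := by gcongr; linarith
  set c := C * N with hc
  have hc0 : 0 ≤ c := by positivity
  have hΓA : ∀ t ∈ Icc (0 : ℝ) 1, ‖Γ (z t) - A (z t)‖ ≤ ρ₁ * c := by
    intro t ht
    exact (hball (z t) ((hb t ht).1.trans_lt hNδ₁)).trans (by gcongr; exact (hb t ht).1)
  have hAz : ∀ x : E, ∀ y v : E, ‖A x y v‖ ≤ a * ‖x‖ * ‖y‖ * ‖v‖ := fun x y v =>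
    (((A x).le_opNorm₂ y v).trans (by gcongr; exact hAa x))
  have hΓk : ∀ t ∈ Icc (0 : ℝ) 1, ‖Γ (z t)‖ ≤ k * c := by
    intro t ht
    have h1 : ‖A (z t)‖ ≤ a * c := (hAa _).trans (mul_le_mul_of_nonneg_left (hb t ht).1 ha0)
    calc ‖Γ (z t)‖ ≤ ‖Γ (z t) - A (z t)‖ + ‖A (z t)‖ := norm_le_norm_sub_add _ _
      _ ≤ ρ₁ * c + a * c := add_le_add (hΓA t ht) h1
      _ = k * c := by rw [hk]; ring
  have hder : ∀ v : ℝ → E, (∀ t ∈ Icc (0 : ℝ) 1, ‖v t‖ ≤ c) → ∀ t ∈ Icc (0 : ℝ) 1,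
      ‖-Γ (z t) (v t) (u t)‖ ≤ k * c ^ 3 := by
    intro v hv t ht
    rw [norm_neg]
    calc ‖Γ (z t) (v t) (u t)‖ ≤ ‖Γ (z t)‖ * ‖v t‖ * ‖u t‖ := (Γ (z t)).le_opNorm₂ _ _
      _ ≤ (k * c) * c * c := by
        gcongr
        · exact hΓk t ht
        · exact hv t ht
        · exact (hb t ht).2.1
      _ = k * c ^ 3 := by ring
  have h01 : (0 : ℝ) ∈ Icc (0 : ℝ) 1 := left_mem_Icc.2 zero_le_one
  have hvar : ∀ v v' : ℝ → E, (∀ t ∈ Icc (0 : ℝ) 1, HasDerivAt v (v' t) t) → ∀ D, 0 ≤ D →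
      (∀ t ∈ Icc (0 : ℝ) 1, ‖v' t‖ ≤ D) → ∀ t ∈ Icc (0 : ℝ) 1, ‖v t - v 0‖ ≤ D := by
    intro v v' hv D hD hb t ht
    have := norm_image_sub_le_of_norm_deriv_le_segment' (fun s hs => (hv s hs).hasDerivWithinAt)
      (fun s hs => hb s (Ico_subset_Icc_self hs)) t ht
    refine this.trans ?_
    rw [sub_zero]
    exact mul_le_of_le_one_right hD ht.2
  have hkc : 0 ≤ k * c ^ 3 := by positivity
  have hu' := hvar u _ hu _ hkc (hder u fun t ht => (hb t ht).2.1)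
  have hw' := hvar w _ hw _ hkc (hder w fun t ht => (hb t ht).2.2)
  have hz' : ∀ t ∈ Icc (0 : ℝ) 1, ‖z t - (z 0 + t • u 0)‖ ≤ k * c ^ 3 := by
    intro t ht
    have h1 := hvar (fun t => z t - t • u 0) (fun t => u t - u 0) (fun t ht => by
      simpa using (hz t ht).fun_sub ((hasDerivAt_id t).smul_const (u 0))) _ hkc hu' t ht
    simpa [sub_sub, add_comm] using h1
  have herr : ∀ t ∈ Icc (0 : ℝ) 1,
      ‖-Γ (z t) (w t) (u t) - (-A (z 0) (w 0) (u 0) - t • A (u 0) (w 0) (u 0))‖ ≤ ρ * N ^ 3 := by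
    intro t ht
    have hq : ‖z 0 + t • u 0‖ ≤ 2 * c := by
      refine (norm_add_le _ _).trans ?_
      rw [norm_smul, Real.norm_of_nonneg ht.1]
      nlinarith [(hb 0 h01).1, (hb 0 h01).2.1, ht.1, ht.2, norm_nonneg (u 0)]
    -- Telescoping: `Γ` is replaced by `A`, then `z` by its tangent line, `w` by `w 0` and `u` by `u
    -- 0`. The first replacement costs `o(N³)`. The others cost `O(N⁵)`, as each of the three curves
    -- differs from its replacement by `O(N³)`.
    have e : -Γ (z t) (w t) (u t) - (-A (z 0) (w 0) (u 0) - t • A (u 0) (w 0) (u 0)) =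
        -((Γ (z t) - A (z t)) (w t) (u t) + A (z t - (z 0 + t • u 0)) (w t) (u t) +
          A (z 0 + t • u 0) (w t - w 0) (u t) + A (z 0 + t • u 0) (w 0) (u t - u 0)) := by
      simp only [map_sub, map_add, map_smul, sub_apply, add_apply, smul_apply]
      module
    rw [e, norm_neg]
    have b1 : ‖(Γ (z t) - A (z t)) (w t) (u t)‖ ≤ (ρ₁ * c) * c * c :=
      ((Γ (z t) - A (z t)).le_opNorm₂ _ _).trans (by
        gcongr
        · exact hΓA t ht
        · exact (hb t ht).2.2
        · exact (hb t ht).2.1)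
    have b2 : ‖A (z t - (z 0 + t • u 0)) (w t) (u t)‖ ≤ a * (k * c ^ 3) * c * c :=
      (hAz _ _ _).trans (by
        gcongr
        · exact hz' t ht
        · exact (hb t ht).2.2
        · exact (hb t ht).2.1)
    have b3 : ‖A (z 0 + t • u 0) (w t - w 0) (u t)‖ ≤ a * (2 * c) * (k * c ^ 3) * c :=
      (hAz _ _ _).trans (by
        gcongr
        · exact hw' t ht
        · exact (hb t ht).2.1)
    have b4 : ‖A (z 0 + t • u 0) (w 0) (u t - u 0)‖ ≤ a * (2 * c) * c * (k * c ^ 3) :=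
      (hAz _ _ _).trans (by
        gcongr
        · exact (hb 0 h01).2.2
        · exact hu' t ht)
    calc _ ≤ (ρ₁ * c) * c * c + a * (k * c ^ 3) * c * c + a * (2 * c) * (k * c ^ 3) * c +
          a * (2 * c) * c * (k * c ^ 3) := norm_add₄_le.trans (by gcongr)
      _ = ρ₁ * C ^ 3 * N ^ 3 + B * N ^ 5 := by rw [hB, hc]; ring
      _ ≤ ρ / 2 * N ^ 3 + ρ / 2 * N ^ 3 := by gcongr
      _ = ρ * N ^ 3 := by ring
  intro t ht
  have h1 := hvar
    (fun t => w t - (-(t • A (z 0) (w 0) (u 0)) - (t ^ 2 / 2) • A (u 0) (w 0) (u 0)))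
    (fun t => -Γ (z t) (w t) (u t) - (-A (z 0) (w 0) (u 0) - t • A (u 0) (w 0) (u 0)))
    (fun t ht => by
      have d1 : HasDerivAt (fun t : ℝ => t ^ 2 / 2) t t := by
        simpa using ((hasDerivAt_id t).pow 2).div_const 2
      have d2 := ((hasDerivAt_id t).smul_const (A (z 0) (w 0) (u 0))).fun_neg.fun_sub
        (d1.smul_const (A (u 0) (w 0) (u 0)))
      simpa using (hw t ht).fun_sub d2) _ (by positivity) herr t ht
  convert h1 using 2
  simp
  abel

/-- The expansion of small geodesics to third order. -/
theorem geodesic_expansion (h0 : Γ 0 = 0) {A : E →L[ℝ] E →L[ℝ] E →L[ℝ] E}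
    (hA : HasFDerivAt Γ A 0) {C : ℝ} (hC : 0 ≤ C) {ρ : ℝ} (hρ : 0 < ρ) :
    ∃ δ > 0, ∀ N, 0 ≤ N → N ≤ δ → ∀ z u : ℝ → E,
      (∀ t ∈ Icc (0 : ℝ) 1, HasDerivAt z (u t) t) →
      (∀ t ∈ Icc (0 : ℝ) 1, HasDerivAt u (-Γ (z t) (u t) (u t)) t) →
      (∀ t ∈ Icc (0 : ℝ) 1, ‖z t‖ ≤ C * N ∧ ‖u t‖ ≤ C * N) →
        ‖z 1 - (z 0 + u 0 - (1 / 2 : ℝ) • A (z 0) (u 0) (u 0)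
          - (1 / 6 : ℝ) • A (u 0) (u 0) (u 0))‖ ≤ ρ * N ^ 3 := by
  obtain ⟨δ, hδ, H⟩ := parallel_expansion h0 hA hC hρ
  refine ⟨δ, hδ, fun N hN hNδ z u hz hu hb => ?_⟩
  -- The velocity of a geodesic is itself parallel; integrating its expansion gives that of the
  -- position.
  have h1 := H N hN hNδ z u u hz hu hu fun t ht => ⟨(hb t ht).1, (hb t ht).2, (hb t ht).2⟩
  have h2 := norm_image_sub_le_of_norm_deriv_le_segment_01'
    (f := fun t => z t - (t • u 0 - (t ^ 2 / 2) • A (z 0) (u 0) (u 0)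
      - (t ^ 3 / 6) • A (u 0) (u 0) (u 0)))
    (f' := fun t => u t - (u 0 - t • A (z 0) (u 0) (u 0) - (t ^ 2 / 2) • A (u 0) (u 0) (u 0)))
    (fun t ht => by
      have d1 : HasDerivAt (fun t : ℝ => t ^ 2 / 2) t t := by
        simpa using ((hasDerivAt_id t).pow 2).div_const 2
      have d3 : HasDerivAt (fun t : ℝ => t ^ 3 / 6) (t ^ 2 / 2) t := by
        refine (((hasDerivAt_id t).pow 3).div_const 6).congr_deriv ?_
        simp only [id]
        push_cast
        ring
      have d2 := (((hasDerivAt_id t).smul_const (u 0)).fun_sub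
        (d1.smul_const (A (z 0) (u 0) (u 0)))).fun_sub (d3.smul_const (A (u 0) (u 0) (u 0)))
      simp only [one_smul] at d2
      exact ((hz t ht).fun_sub d2).hasDerivWithinAt) (fun t ht => h1 t (Ico_subset_Icc_self ht))
  convert h2 using 2
  norm_num
  abel

end GeodesicLoop

/-! ### Existence and size of small geodesics up to time 1 -/

namespace GeodesicLoop

open Filter Topology

variable {E : Type*} [NormedAddCommGroup E] [NormedSpace ℝ E]
  {Γ : E → E →L[ℝ] E →L[ℝ] E}

theorem norm_le_exp_mul {v v' : ℝ → E} {K N : ℝ} (hK : 0 ≤ K)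
    (hv : ∀ t ∈ Icc (0 : ℝ) 1, HasDerivAt v (v' t) t) (h0 : ‖v 0‖ ≤ N)
    (hb : ∀ t ∈ Icc (0 : ℝ) 1, ‖v' t‖ ≤ K * ‖v t‖) : ∀ t ∈ Icc (0 : ℝ) 1, ‖v t‖ ≤ Real.exp K * N := by
  intro t ht
  have h := norm_le_gronwallBound_of_norm_deriv_right_le (K := K) (ε := 0)
    (fun s hs => (hv s hs).continuousAt.continuousWithinAt)
    (fun s hs => (hv s (Ico_subset_Icc_self hs)).hasDerivWithinAt) h0
    (fun s hs => by simpa using hb s (Ico_subset_Icc_self hs)) t ht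
  rw [gronwallBound_ε0, sub_zero, mul_comm] at h
  refine h.trans ?_
  have hN : 0 ≤ N := (norm_nonneg _).trans h0
  gcongr
  exact mul_le_of_le_one_right hK ht.2

/-- The equation of geodesics, with parallel transport along them, as a vector field. -/
def transportField (Γ : E → E →L[ℝ] E →L[ℝ] E) (x : E × E × E) : E × E × E :=
  (x.2.1, -Γ x.1 x.2.1 x.2.1, -Γ x.1 x.2.2 x.2.1)

theorem contDiffOn_transportField {U : Set E} (hΓ : ContDiffOn ℝ ∞ Γ U) :
    ContDiffOn ℝ ∞ (transportField Γ) {x | x.1 ∈ U} := by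
  have h1 : ContDiffOn ℝ ∞ (fun x : E × E × E => Γ x.1) {x | x.1 ∈ U} :=
    hΓ.comp contDiffOn_fst fun x hx => hx
  have h2 : ContDiff ℝ ∞ (fun x : E × E × E => x.2.1) := contDiff_snd.fst
  have h3 : ContDiff ℝ ∞ (fun x : E × E × E => x.2.2) := contDiff_snd.snd
  exact h2.contDiffOn.prodMk (((h1.clm_apply h2.contDiffOn).clm_apply h2.contDiffOn).neg.prodMk
    ((h1.clm_apply h3.contDiffOn).clm_apply h2.contDiffOn).neg)

/-- Small geodesics, and parallel transport along them, exist up to time `1`; their size is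
controlled by the initial data. -/
theorem exists_isGeodesicSol [CompleteSpace E] {U : Set E} (hU : IsOpen U) (hU0 : (0 : E) ∈ U)
    (hΓ : ContDiffOn ℝ ∞ Γ U) :
    ∃ δ > 0, ∃ C, 0 ≤ C ∧ ∀ N ≤ δ, ∀ z₀ u₀ w₀ : E, ‖z₀‖ ≤ N → ‖u₀‖ ≤ N → ‖w₀‖ ≤ N →
      ∃ z u w : ℝ → E, z 0 = z₀ ∧ u 0 = u₀ ∧ w 0 = w₀ ∧
        IsGeodesicSol Γ U z u (Ioo (-1) 2) ∧
        (∀ t ∈ Ioo (-1 : ℝ) 2, HasDerivAt w (-Γ (z t) (w t) (u t)) t) ∧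
        ContDiffOn ℝ ∞ z (Ioo (-1) 2) ∧ ContDiffOn ℝ ∞ w (Ioo (-1) 2) ∧
        ∀ t ∈ Icc (0 : ℝ) 1, ‖z t‖ ≤ C * N ∧ ‖u t‖ ≤ C * N ∧ ‖w t‖ ≤ C * N := by
  have hV : IsOpen {x : E × E × E | x.1 ∈ U} := hU.preimage continuous_fst
  have hF := contDiffOn_transportField hΓ
  have hF0 : ContDiffAt ℝ 1 (transportField Γ) 0 :=
    (hF.contDiffAt (hV.mem_nhds hU0)).of_le (by simp)
  obtain ⟨ε, hε, a, r, L, K, hr, hpl⟩ := IsPicardLindelof.of_contDiffAt_one hF0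
  obtain ⟨α, hα, hαc⟩ := (hpl 0).exists_forall_mem_closedBall_eq_hasDerivWithinAt_continuousOn
  simp only [zero_sub, zero_add] at hα hαc
  set k := ‖Γ 0‖ + 1 with hk
  have hk0 : 0 ≤ k := by positivity
  -- Bounds on `Γ` and on the velocity make the equations for `u` and `w` linearly bounded, as
  -- Grönwall's inequality requires.
  set W : Set (E × E × E) := {x | x.1 ∈ U ∧ ‖Γ x.1‖ < k ∧ ‖x.2.1‖ < 1} with hW
  have hW0 : W ∈ 𝓝 (0 : E × E × E) := by
    have h1 : ContinuousAt (fun x : E × E × E => ‖Γ x.1‖) 0 :=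
      (((hΓ.continuousOn.continuousAt (hU.mem_nhds hU0)).comp
        (x := (0 : E × E × E)) continuousAt_fst)).norm
    have h2 : ContinuousAt (fun x : E × E × E => ‖x.2.1‖) 0 := by fun_prop
    filter_upwards [hV.mem_nhds hU0, Tendsto.eventually_lt_const (show ‖Γ 0‖ < k by simp [hk]) h1,
      Tendsto.eventually_lt_const (show ‖(0 : E)‖ < 1 by simp) h2] with x a b c using ⟨a, b, c⟩
  have hmem : Metric.closedBall (0 : E × E × E) r ×ˢ Icc (-ε) ε ∈ 𝓝 ((0 : E × E × E), (0 : ℝ)) :=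
    prod_mem_nhds (Metric.closedBall_mem_nhds _ hr) (Icc_mem_nhds (by simpa) hε)
  have hα0 : α (0, 0) = 0 := (hα 0 (by simp)).1
  have hαW : α ⁻¹' W ∈ 𝓝 ((0 : E × E × E), (0 : ℝ)) :=
    (hαc.continuousAt hmem).preimage_mem_nhds (by rwa [hα0])
  obtain ⟨ρ, hρ, hball⟩ := Metric.mem_nhds_iff.1 (inter_mem hαW
    (prod_mem_nhds (Metric.closedBall_mem_nhds (0 : E × E × E) hr)
      (Ioo_mem_nhds (show -ε < 0 by simpa) hε)))
  -- With this factor, `η * t` stays within `ρ` for `t` in `(-3, 3)`, which contains the time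
  -- interval needed.
  set η := ρ / 4 with hη
  have hη0 : 0 < η := by positivity
  refine ⟨min (ρ / 2) (η * (ρ / 2)), by positivity, 1 + Real.exp (k * η), by positivity, ?_⟩
  intro N hN z₀ u₀ w₀ hz₀ hu₀ hw₀
  have hN0 : 0 ≤ N := (norm_nonneg _).trans hz₀
  -- The local flow exists only for short time. It is run at time `η * t` from velocity `η⁻¹ • u₀`,
  -- and the resulting velocity is multiplied by `η`. The transported vector needs no rescaling, its
  -- equation being linear in the velocity.
  set x₀ : E × E × E := (z₀, η⁻¹ • u₀, w₀) with hx₀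
  have hx₀ρ : ‖x₀‖ < ρ := by
    have h1 : N ≤ ρ / 2 := hN.trans (min_le_left _ _)
    have h2 : N ≤ η * (ρ / 2) := hN.trans (min_le_right _ _)
    have h3 : ‖η⁻¹ • u₀‖ < ρ := by
      rw [norm_smul, norm_inv, Real.norm_of_nonneg hη0.le, inv_mul_lt_iff₀ hη0]
      nlinarith
    rw [hx₀, Prod.norm_def, Prod.norm_def]
    exact max_lt (by simp only; linarith) (max_lt h3 (by simp only; linarith))
  have hin : ∀ t ∈ Ioo (-3 : ℝ) 3, α (x₀, η * t) ∈ W ∧ x₀ ∈ Metric.closedBall 0 (r : ℝ) ∧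
      η * t ∈ Ioo (-ε) ε := by
    intro t ht
    have : (x₀, η * t) ∈ Metric.ball ((0 : E × E × E), (0 : ℝ)) ρ := by
      rw [mem_ball_iff_norm, ← Prod.zero_eq_mk, sub_zero, Prod.norm_def]
      refine max_lt hx₀ρ ?_
      simp only [Real.norm_eq_abs, abs_lt]
      constructor <;> nlinarith [ht.1, ht.2]
    exact ⟨(hball this).1, (hball this).2.1, (hball this).2.2⟩
  have hx₀r : x₀ ∈ Metric.closedBall 0 (r : ℝ) := (hin 0 (by norm_num)).2.1
  set β : ℝ → E × E × E := fun t => α (x₀, η * t) with hβ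
  have hβd : ∀ t ∈ Ioo (-3 : ℝ) 3, HasDerivAt β (η • transportField Γ (β t)) t := by
    intro t ht
    have h1 := (hin t ht).2.2
    have h2 := ((hα x₀ hx₀r).2 _ (Ioo_subset_Icc_self h1)).hasDerivAt (Icc_mem_nhds h1.1 h1.2)
    have h3 := (hasDerivAt_id t).const_mul η
    rw [mul_one] at h3
    exact h2.scomp t h3
  set g : ℝ → E × E × E := fun t => ((β t).1, η • (β t).2.1, (β t).2.2) with hg
  have hgd : ∀ t ∈ Ioo (-3 : ℝ) 3, HasDerivAt g (transportField Γ (g t)) t := by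
    intro t ht
    have h1 := hβd t ht
    have h2 := h1.hasFDerivAt.fst.hasDerivAt.prodMk
      ((h1.hasFDerivAt.snd.fst.hasDerivAt.const_smul η).prodMk h1.hasFDerivAt.snd.snd.hasDerivAt)
    refine h2.congr_deriv ?_
    simp [transportField, hg, smul_smul]
  have hgV : ∀ t ∈ Ioo (-3 : ℝ) 3, g t ∈ {x : E × E × E | x.1 ∈ U} := fun t ht => (hin t ht).1.1
  have hsub : Icc (-1 : ℝ) 2 ⊆ Ioo (-3) 3 := fun t ht => ⟨by linarith [ht.1], by linarith [ht.2]⟩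
  have hsub' : Ioo (-1 : ℝ) 2 ⊆ Ioo (-3) 3 := Ioo_subset_Icc_self.trans hsub
  have hsub'' : Icc (0 : ℝ) 1 ⊆ Ioo (-3) 3 := fun t ht => ⟨by linarith [ht.1], by linarith [ht.2]⟩
  have hgs : ContDiffOn ℝ ∞ g (Ioo (-1) 2) := by
    refine (ODE.contDiffOn_enat_Icc_of_hasDerivWithinAt (n := ⊤) (f := fun _ => transportField Γ)
      (u := {x : E × E × E | x.1 ∈ U}) ?_ (fun t ht => (hgd t (hsub ht)).hasDerivWithinAt)
      fun t ht => hgV t (hsub ht)).mono Ioo_subset_Icc_self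
    exact hF.comp contDiffOn_snd fun x hx => hx.2
  have hz : ∀ t ∈ Ioo (-3 : ℝ) 3, HasDerivAt (fun t => (g t).1) (g t).2.1 t := fun t ht =>
    (hgd t ht).hasFDerivAt.fst.hasDerivAt.congr_deriv (by simp [transportField])
  have hu : ∀ t ∈ Ioo (-3 : ℝ) 3, HasDerivAt (fun t => (g t).2.1)
      (-Γ (g t).1 (g t).2.1 (g t).2.1) t := fun t ht =>
    (hgd t ht).hasFDerivAt.snd.fst.hasDerivAt.congr_deriv (by simp [transportField])
  have hw : ∀ t ∈ Ioo (-3 : ℝ) 3, HasDerivAt (fun t => (g t).2.2)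
      (-Γ (g t).1 (g t).2.2 (g t).2.1) t := fun t ht =>
    (hgd t ht).hasFDerivAt.snd.snd.hasDerivAt.congr_deriv (by simp [transportField])
  have hβ0 : β 0 = x₀ := by
    have := (hα x₀ hx₀r).1
    simpa [hβ] using this
  have hz0 : (g 0).1 = z₀ := by simp [hg, hβ0, hx₀]
  have hu0 : (g 0).2.1 = u₀ := by simp [hg, hβ0, hx₀, smul_smul, hη0.ne']
  have hw0 : (g 0).2.2 = w₀ := by simp [hg, hβ0, hx₀]
  have hder : ∀ t ∈ Icc (0 : ℝ) 1, ∀ v : E, ‖-Γ (g t).1 v (g t).2.1‖ ≤ k * η * ‖v‖ := by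
    intro t ht v
    obtain ⟨h1, h2, h3⟩ := (hin t (hsub'' ht)).1
    have h4 : ‖(g t).2.1‖ ≤ η := by
      simp only [hg, norm_smul, Real.norm_of_nonneg hη0.le]
      exact mul_le_of_le_one_right hη0.le h3.le
    rw [norm_neg]
    calc ‖Γ (g t).1 v (g t).2.1‖ ≤ ‖Γ (g t).1‖ * ‖v‖ * ‖(g t).2.1‖ := (Γ _).le_opNorm₂ _ _
      _ ≤ k * ‖v‖ * η := by gcongr
      _ = k * η * ‖v‖ := by ring
  have hkη : 0 ≤ k * η := by positivity
  have hub := norm_le_exp_mul hkη (fun t ht => hu t (hsub'' ht)) (hu0 ▸ hu₀)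
    fun t ht => hder t ht _
  have hwb := norm_le_exp_mul hkη (fun t ht => hw t (hsub'' ht)) (hw0 ▸ hw₀)
    fun t ht => hder t ht _
  refine ⟨fun t => (g t).1, fun t => (g t).2.1, fun t => (g t).2.2, hz0, hu0, hw0,
    ⟨fun t ht => hgV t (hsub' ht), fun t ht => hz t (hsub' ht), fun t ht => hu t (hsub' ht)⟩,
    fun t ht => hw t (hsub' ht), hgs.fst, hgs.snd.snd, fun t ht => ⟨?_, ?_, ?_⟩⟩
  · have h1 := norm_image_sub_le_of_norm_deriv_le_segment'
      (fun s hs => (hz s (hsub'' hs)).hasDerivWithinAt)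
      (fun s hs => hub s (Ico_subset_Icc_self hs)) t ht
    rw [hz0, sub_zero] at h1
    have h2 : 0 ≤ Real.exp (k * η) * N := by positivity
    have h3 := norm_le_norm_add_norm_sub' (g t).1 z₀
    nlinarith [ht.2]
  · exact (hub t ht).trans (by linarith)
  · exact (hwb t ht).trans (by linarith)

end GeodesicLoop

/-! ### Algebra of the cubic terms -/

namespace GeodesicLoop

open Filter Topology

variable {E : Type*} [NormedAddCommGroup E] [NormedSpace ℝ E]

theorem norm_trilinear_sub_le (A : E →L[ℝ] E →L[ℝ] E →L[ℝ] E) {x y z x' y' z' : E} {D R : ℝ}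
    (hx : ‖x - x'‖ ≤ D) (hy : ‖y - y'‖ ≤ D) (hz : ‖z - z'‖ ≤ D) (hx' : ‖x'‖ ≤ R) (hyR : ‖y‖ ≤ R)
    (hy' : ‖y'‖ ≤ R) (hzR : ‖z‖ ≤ R) : ‖A x y z - A x' y' z'‖ ≤ 3 * ‖A‖ * R ^ 2 * D := by
  have hD : 0 ≤ D := (norm_nonneg _).trans hx
  have hR : 0 ≤ R := (norm_nonneg _).trans hx'
  have hA : ∀ x y v : E, ‖A x y v‖ ≤ ‖A‖ * ‖x‖ * ‖y‖ * ‖v‖ := fun x y v =>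
    ((A x).le_opNorm₂ y v).trans (by gcongr; exact A.le_opNorm x)
  have e : A x y z - A x' y' z' = A (x - x') y z + A x' (y - y') z + A x' y' (z - z') := by
    simp only [map_sub, sub_apply]
    abel
  rw [e]
  calc _ ≤ ‖A‖ * D * R * R + ‖A‖ * R * D * R + ‖A‖ * R * R * D := by
        refine norm_add₃_le.trans (add_le_add (add_le_add ?_ ?_) ?_)
        · exact (hA _ _ _).trans (by gcongr)
        · exact (hA _ _ _).trans (by gcongr)
        · exact (hA _ _ _).trans (by gcongr)
    _ = _ := by ring

theorem trilinear_smul₃ (A : E →L[ℝ] E →L[ℝ] E →L[ℝ] E) (s : ℝ) (x y z : E) :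
    A (s • x) (s • y) (s • z) = s ^ 3 • A x y z := by
  simp only [map_smul, smul_apply, smul_smul]
  congr 1
  ring

/-- Cubic terms that agree to third order are equal. -/
theorem trilinear_eq_of_norm_sub_le (A B : E →L[ℝ] E →L[ℝ] E →L[ℝ] E) {x y x' y' : E} {z z' : E}
    (h : ∀ ρ > 0, ∃ δ > 0, ∀ s > 0, s ≤ δ →
      ‖A (s • x) (s • y) (s • z) - B (s • x') (s • y') (s • z')‖ ≤ ρ * s ^ 3) :
    A x y z = B x' y' z' := by
  rw [← sub_eq_zero, ← norm_le_zero_iff]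
  refine le_of_forall_pos_le_add fun ρ hρ => ?_
  obtain ⟨δ, hδ, H⟩ := h ρ hρ
  have h1 := H δ hδ le_rfl
  rw [trilinear_smul₃, trilinear_smul₃, ← smul_sub, norm_smul, Real.norm_of_nonneg (by positivity),
    mul_comm] at h1
  rw [zero_add]
  exact le_of_mul_le_mul_right h1 (by positivity)

/-- The defect of left diassociativity to third order. -/
theorem norm_sub_le_of_product (A : E →L[ℝ] E →L[ℝ] E →L[ℝ] E) (hA : ∀ v, A v v v = 0)
    {x y xx xy r : E} {D R η : ℝ} (hx : ‖x‖ ≤ R) (hy : ‖y‖ ≤ R) (hxx : ‖xx‖ ≤ R) (hxy : ‖xy‖ ≤ R)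
    (hx2 : ‖x + x‖ ≤ R) (hxy2 : ‖x + y‖ ≤ R)
    (d1 : ‖xx - (x + x)‖ ≤ D) (d2 : ‖xy - (x + y)‖ ≤ D)
    (e1 : ‖xx - (x + x)‖ ≤ η)
    (e2 : ‖xy - (x + y - (1 / 2 : ℝ) • A y x y - (1 / 2 : ℝ) • A y x x)‖ ≤ η)
    (e3 : ‖r - (x + xy - (1 / 2 : ℝ) • A xy x xy - (1 / 2 : ℝ) • A xy x x)‖ ≤ η)
    (e4 : ‖r - (xx + y - (1 / 2 : ℝ) • A y xx y - (1 / 2 : ℝ) • A y xx xx)‖ ≤ η) :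
    ‖A y x x - A x x y‖ ≤ 8 * η + 4 * (3 * ‖A‖ * R ^ 2 * D) := by
  have hD : 0 ≤ D := (norm_nonneg _).trans d1
  have hDx : ‖x - x‖ ≤ D := by simpa
  have hDy : ‖y - y‖ ≤ D := by simpa
  have f1 := norm_trilinear_sub_le A d2 hDx d2 hxy2 hx hx hxy
  have f2 := norm_trilinear_sub_le A d2 hDx hDx hxy2 hx hx hx
  have f3 := norm_trilinear_sub_le A hDy d1 hDy hy hxx hx2 hy
  have f4 := norm_trilinear_sub_le A hDy d1 d1 hy hxx hx2 hxx
  -- Twice the difference of the two expansions of `r`, after expanding `xy` and `xx`. Inside `A`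
  -- these are replaced by `x + y` and `x + x`; since they differ from the sums by `D`, which is
  -- cubic in the application, each replacement costs fifth order.
  have key : A y x x - A x x y =
      (2 : ℝ) • (r - (xx + y - (1 / 2 : ℝ) • A y xx y - (1 / 2 : ℝ) • A y xx xx))
      - (2 : ℝ) • (r - (x + xy - (1 / 2 : ℝ) • A xy x xy - (1 / 2 : ℝ) • A xy x x))
      - (2 : ℝ) • (xy - (x + y - (1 / 2 : ℝ) • A y x y - (1 / 2 : ℝ) • A y x x))
      + (2 : ℝ) • (xx - (x + x))
      + (A xy x xy - A (x + y) x (x + y)) + (A xy x x - A (x + y) x x)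
      - (A y xx y - A y (x + x) y) - (A y xx xx - A y (x + x) (x + x)) + (2 : ℝ) • A x x x := by
    simp only [map_add, add_apply]
    module
  rw [key, hA, smul_zero, add_zero]
  have two : ∀ v : E, ‖v‖ ≤ η → ‖(2 : ℝ) • v‖ ≤ 2 * η := fun v hv => by
    rw [norm_smul]
    norm_num
    exact hv
  refine (norm_sub_le_of_le (norm_sub_le_of_le (norm_add_le_of_le (norm_add_le_of_le
    (norm_add_le_of_le (norm_sub_le_of_le (norm_sub_le_of_le (two _ e4) (two _ e3)) (two _ e2))
    (two _ e1)) f1) f2) f3) f4).trans ?_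
  linarith

/-- The product differs from the sum by third order terms. -/
theorem norm_sub_add_le_of_product (A : E →L[ℝ] E →L[ℝ] E →L[ℝ] E) {x y m : E} {N : ℝ}
    (hx : ‖x‖ ≤ N) (hy : ‖y‖ ≤ N)
    (e : ‖m - (x + y - (1 / 2 : ℝ) • A y x y - (1 / 2 : ℝ) • A y x x)‖ ≤ N ^ 3) :
    ‖m - (x + y)‖ ≤ (1 + ‖A‖) * N ^ 3 := by
  have hN : 0 ≤ N := (norm_nonneg _).trans hx
  have hAb : ∀ u v w : E, ‖u‖ ≤ N → ‖v‖ ≤ N → ‖w‖ ≤ N →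
      ‖(1 / 2 : ℝ) • A u v w‖ ≤ 1 / 2 * (‖A‖ * N ^ 3) := by
    intro u v w hu hv hw
    rw [norm_smul, Real.norm_of_nonneg (by norm_num)]
    gcongr
    calc ‖A u v w‖ ≤ ‖A u‖ * ‖v‖ * ‖w‖ := (A u).le_opNorm₂ v w
      _ ≤ (‖A‖ * N) * N * N := by
        gcongr
        exact (A.le_opNorm u).trans (by gcongr)
      _ = _ := by ring
  have h : m - (x + y) = (m - (x + y - (1 / 2 : ℝ) • A y x y - (1 / 2 : ℝ) • A y x x))
      - (1 / 2 : ℝ) • A y x y - (1 / 2 : ℝ) • A y x x := by module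
  rw [h]
  refine (norm_sub_le_of_le (norm_sub_le_of_le e (hAb _ _ _ hy hx hy)) (hAb _ _ _ hy hx hx)).trans ?_
  linarith

/-- If a local product `P` has the given expansion to third order, and is left diassociative,
then the third order terms satisfy a symmetry. -/
theorem trilinear_symm_of_product (A : E →L[ℝ] E →L[ℝ] E →L[ℝ] E) (hA : ∀ v, A v v v = 0)
    {P : E → E → E → Prop}
    (hP : ∀ ρ > 0, ∃ δ > 0, ∀ N ≤ δ, ∀ a b, ‖a‖ ≤ N → ‖b‖ ≤ N → ∃ m, P a b m ∧
      ‖m - (a + b - (1 / 2 : ℝ) • A b a b - (1 / 2 : ℝ) • A b a a)‖ ≤ ρ * N ^ 3)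
    (hd : ∀ x y xy xx r s, P x y xy → P x xy r → P x x xx → P xx y s → r = s) (x y : E) :
    A y x x = A x x y := by
  refine trilinear_eq_of_norm_sub_le A A fun ρ hρ => ?_
  set a := ‖A‖ with ha
  have ha0 : 0 ≤ a := norm_nonneg _
  -- Chosen so that a product of two vectors of size `N` has size at most `κ * N` and can be
  -- multiplied again.
  set κ := 3 + a with hκ
  have hκ0 : 0 < κ := by positivity
  set b := ‖x‖ + ‖y‖ + 1 with hb
  have hb0 : 0 < b := by positivity
  -- The factor `b ^ 3` converts between `s` and `N = s * b`; the bound by 1 yields `η ≤ N ^ 3`.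
  set ρ' := min 1 (ρ / b ^ 3) with hρ'
  have hρ'0 : 0 < ρ' := by positivity
  obtain ⟨δ, hδ, H⟩ := hP (ρ' / (16 * κ ^ 3)) (by positivity)
  -- Makes the fifth order terms at most `ρ' / 2 * N ^ 3`; the factor 16 above leaves the other half
  -- for `8 * η`.
  set B := 24 * a * κ ^ 3 + 1 with hB
  have hB0 : 0 < B := by positivity
  refine ⟨min 1 (min (δ / κ) (ρ' / B)) / b, by positivity, fun s hs hsδ => ?_⟩
  rw [le_div_iff₀ hb0] at hsδ
  set N := s * b with hN
  have hN0 : 0 < N := by positivity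
  have hN1 : N ≤ 1 := hsδ.trans (min_le_left _ _)
  have hNδ : κ * N ≤ δ := by
    have := hsδ.trans ((min_le_right _ _).trans (min_le_left _ _))
    rwa [le_div_iff₀ hκ0, mul_comm] at this
  have hNB : B * N ≤ ρ' := by
    have := hsδ.trans ((min_le_right _ _).trans (min_le_right _ _))
    rwa [le_div_iff₀ hB0, mul_comm] at this
  have hNκ : N ≤ κ * N := le_mul_of_one_le_left hN0.le (by linarith)
  set η := ρ' / (16 * κ ^ 3) * (κ * N) ^ 3 with hη
  have hη1 : η = ρ' / 16 * N ^ 3 := by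
    rw [hη]
    field_simp
  have hN3 : N ^ 3 ≤ N := pow_le_of_le_one hN0.le hN1 (by norm_num)
  have hN30 : 0 < N ^ 3 := by positivity
  have hηN : η ≤ N ^ 3 := by
    rw [hη1]
    have : ρ' ≤ 1 := min_le_left _ _
    exact mul_le_of_le_one_left hN30.le (by linarith)
  have hx : ‖s • x‖ ≤ N := by
    rw [norm_smul, Real.norm_of_nonneg hs.le, hN]
    gcongr
    linarith [norm_nonneg y]
  have hy : ‖s • y‖ ≤ N := by
    rw [norm_smul, Real.norm_of_nonneg hs.le, hN]
    gcongr
    linarith [norm_nonneg x]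
  suffices h : ‖A (s • y) (s • x) (s • x) - A (s • x) (s • x) (s • y)‖ ≤ ρ' * N ^ 3 by
    refine h.trans ?_
    calc ρ' * N ^ 3 ≤ ρ / b ^ 3 * N ^ 3 := by gcongr; exact min_le_right _ _
      _ = ρ * s ^ 3 := by rw [hN]; field_simp
  generalize s • x = x at *
  generalize s • y = y at *
  obtain ⟨xx, hxx, e1⟩ := H _ hNδ x x (hx.trans hNκ) (hx.trans hNκ)
  obtain ⟨xy, hxy, e2⟩ := H _ hNδ x y (hx.trans hNκ) (hy.trans hNκ)
  have hD : (1 + a) * N ^ 3 ≤ κ * N ^ 3 := by gcongr; linarith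
  have d1 := (norm_sub_add_le_of_product A hx hx (e1.trans hηN)).trans hD
  have d2 := (norm_sub_add_le_of_product A hx hy (e2.trans hηN)).trans hD
  have hκN : N + N + (1 + a) * N ^ 3 ≤ κ * N := by
    have : (1 + a) * N ^ 3 ≤ (1 + a) * N := by gcongr
    linarith
  have hx2 : ‖x + x‖ ≤ N + N := norm_add_le_of_le hx hx
  have hxy2 : ‖x + y‖ ≤ N + N := norm_add_le_of_le hx hy
  have hNN : N + N ≤ κ * N := by
    rw [← two_mul]
    gcongr
    linarith
  have b1 : ‖xx‖ ≤ κ * N := by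
    have h1 := norm_sub_add_le_of_product A hx hx (e1.trans hηN)
    have := norm_le_norm_add_norm_sub' xx (x + x)
    linarith
  have b2 : ‖xy‖ ≤ κ * N := by
    have h1 := norm_sub_add_le_of_product A hx hy (e2.trans hηN)
    have := norm_le_norm_add_norm_sub' xy (x + y)
    linarith
  rw [hA, smul_zero, sub_zero, sub_zero] at e1
  obtain ⟨r, hr, e3⟩ := H _ hNδ x xy (hx.trans hNκ) b2
  obtain ⟨s', hs', e4⟩ := H _ hNδ xx y b1 (hy.trans hNκ)
  obtain rfl := hd x y xy xx r s' hxy hr hxx hs'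
  refine (norm_sub_le_of_product A hA (hx.trans hNκ) (hy.trans hNκ) b1 b2 (hx2.trans hNN)
    (hxy2.trans hNN) d1 d2 e1 e2 e3 e4).trans ?_
  have h1 : 24 * a * κ ^ 3 * N ^ 2 ≤ ρ' := by
    have h2 : N ^ 2 ≤ N := pow_le_of_le_one hN0.le hN1 (by norm_num)
    calc 24 * a * κ ^ 3 * N ^ 2 ≤ 24 * a * κ ^ 3 * N := by gcongr
      _ ≤ B * N := by gcongr; linarith
      _ ≤ ρ' := hNB
  calc 8 * η + 4 * (3 * a * (κ * N) ^ 2 * (κ * N ^ 3))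
      = ρ' / 2 * N ^ 3 + 24 * a * κ ^ 3 * N ^ 2 / 2 * N ^ 3 := by rw [hη1]; ring
    _ ≤ ρ' / 2 * N ^ 3 + ρ' / 2 * N ^ 3 := by gcongr
    _ = ρ' * N ^ 3 := by ring

/-- A trilinear form, symmetric in two arguments, vanishes under these symmetries. -/
theorem trilinear_eq_zero (A : E →L[ℝ] E →L[ℝ] E →L[ℝ] E) (hA : ∀ v, A v v v = 0)
    (hs : ∀ x u v, A x u v = A x v u) (h : ∀ x y, A y x x = A x x y) : A = 0 := by
  have h1 : ∀ x y, A y x x = 0 := by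
    intro x y
    have e1 := hA (x + y)
    have e2 := hA (x - y)
    simp only [map_add, map_sub, add_apply, sub_apply, hA, hs x y x, hs y y x] at e1 e2
    -- Subtracting the expansions at `x + y` and `x - y` keeps twice the part odd in `y`. There `A y
    -- y y` vanishes, and the other three terms all equal `A y x x` by `h` and `hs`.
    have e3 : (6 : ℝ) • A y x x = 0 := by
      rw [← sub_eq_zero.2 (e1.trans e2.symm)]
      simp only [h]
      module
    exact (smul_eq_zero.1 e3).resolve_left (by norm_num)
  ext x u v
  have e1 := h1 (u + v) x
  simp only [map_add, add_apply, h1, hs x v u] at e1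
  have e3 : (2 : ℝ) • A x u v = 0 := by
    rw [← e1]
    module
  simpa using (smul_eq_zero.1 e3).resolve_left (by norm_num)

end GeodesicLoop

/-! ### Normal coordinates -/

namespace GeodesicLoop

open Filter Topology

variable {E : Type*} [NormedAddCommGroup E] [NormedSpace ℝ E] [FiniteDimensional ℝ E]
  {M : Type*} [TopologicalSpace M] [ChartedSpace E M] [IsManifold 𝓘(ℝ, E) ∞ M]
  {cov : CovariantDerivative 𝓘(ℝ, E) E (TangentSpace 𝓘(ℝ, E) : M → Type _)}
  {Φ : OpenPartialHomeomorph E M} {Γ : E → E →L[ℝ] E →L[ℝ] E}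

omit [FiniteDimensional ℝ E] in
theorem isParametrization_chartAt_symm (e : M) : IsParametrization (chartAt E e).symm where
  smooth := contMDiffOn_chart_symm
  smooth_symm := by
    rw [OpenPartialHomeomorph.symm_symm]
    exact contMDiffOn_chart

namespace IsRestrictedNormalNhd

omit [FiniteDimensional ℝ E] in
theorem isParametrization {e : M} (hΦ : IsRestrictedNormalNhd cov e Φ) : IsParametrization Φ :=
  ⟨hΦ.smooth, hΦ.smooth_symm⟩

/-- The origin of normal coordinates. -/
theorem apply_zero [T2Space M] (hcov : CovariantDerivative.ContMDiffCovariantDerivative cov ∞)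
    {e : M} (hΦ : IsRestrictedNormalNhd cov e Φ) : Φ 0 = e := by
  -- It is not yet known that `e` lies in `Φ.target`, so the constant geodesic is handled in the
  -- chart at `e`.
  set Ψ : OpenPartialHomeomorph E M := (chartAt E e).symm with hΨ'
  have hΨ : IsParametrization Ψ := isParametrization_chartAt_symm e
  obtain ⟨Γ, hΓ⟩ := hΨ.exists_isChristoffel cov
  have hz : chartAt E e e ∈ Ψ.source := mem_chart_target E e
  have he : Ψ (chartAt E e e) = e := (chartAt E e).left_inv (mem_chart_source E e)
  have hsol : IsGeodesicSol Γ Ψ.source (fun _ => chartAt E e e) (fun _ => 0) univ :=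
    ⟨fun _ _ => hz, fun t _ => hasDerivAt_const t _, fun t _ => by
      simpa using hasDerivAt_const t (0 : E)⟩
  have key : ∀ p q : M, p = q → (⟨p, (0 : TangentSpace 𝓘(ℝ, E) p)⟩ : TangentBundle 𝓘(ℝ, E) M) =
      ⟨q, (0 : TangentSpace 𝓘(ℝ, E) q)⟩ := by
    rintro p _ rfl
    rfl
  refine ((hΦ.isExp 0 hΦ.zero_mem).eq_of_isGeodesicSol hsol hΓ hΨ (hΓ.contDiffOn hΨ hcov)
    isOpen_univ (subset_univ _) ?_).trans he
  refine (key e _ he.symm).trans ?_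
  rw [map_zero]

variable [T2Space M] (hΦ : IsRestrictedNormalNhd cov (Φ 0) Φ) (hΓ : IsChristoffel cov Φ Γ)
  (hΓs : ContDiffOn ℝ ∞ Γ Φ.source)
include hΦ hΓ hΓs

/-- In normal coordinates the radial lines are geodesics. -/
theorem exists_radial : ∃ δ > 0, ∀ v : E, ‖v‖ ≤ δ → ∃ u : ℝ → E,
    u 0 = comp Φ (Φ 0) v ∧ ∃ c : ℝ → E, IsGeodesicSol Γ Φ.source c u (Ioo (-1) 2) ∧
      ∀ s ∈ Icc (0 : ℝ) 1, c s = s • v := by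
  have hP := hΦ.isParametrization
  obtain ⟨δ, hδ, C, hC, H⟩ := exists_isGeodesicSol Φ.open_source hΦ.zero_mem hΓs
  obtain ⟨r, hr, hball⟩ := Metric.mem_nhds_iff.1 (Φ.open_source.mem_nhds hΦ.zero_mem)
  -- The differential of the exponential map at 0 is not yet known to be the identity, so the
  -- tangent vector `v` has components `L v` for now.
  set L : E →L[ℝ] E := comp Φ (Φ 0) with hL
  refine ⟨min (r / 2) (δ / (‖L‖ + 1)), by positivity, fun v hv => ?_⟩
  have hv1 : ‖v‖ ≤ r / 2 := hv.trans (min_le_left _ _)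
  have hv2 : ‖L v‖ ≤ δ := by
    have h1 : ‖v‖ ≤ δ / (‖L‖ + 1) := hv.trans (min_le_right _ _)
    rw [le_div_iff₀ (by positivity)] at h1
    have := L.le_opNorm v
    nlinarith [norm_nonneg v]
  obtain ⟨c, u, -, hc0, hu0, -, hsol, -⟩ := H δ le_rfl 0 (L v) 0 (by simpa using hδ.le) hv2
    (by simpa using hδ.le)
  refine ⟨u, hu0, c, hsol, fun s hs => ?_⟩
  have hsub : ∀ t ∈ Ioo (-1 : ℝ) 2, s * t ∈ Ioo (-1 : ℝ) 2 := fun t ht => by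
    constructor <;> nlinarith [hs.1, hs.2, ht.1, ht.2]
  have hd : ∀ t : ℝ, HasDerivAt (fun t => s * t) s t := fun t => by
    simpa using (hasDerivAt_id t).const_mul s
  -- The geodesic run at speed `s` ends at `Φ (c s)` and is the exponential of `s • v`; injectivity
  -- of `Φ` then gives `c s = s • v`.
  have hsol' : IsGeodesicSol Γ Φ.source (fun t => c (s * t)) (fun t => s • u (s * t))
      (Ioo (-1) 2) := by
    refine ⟨fun t ht => hsol.mem _ (hsub t ht), fun t ht => ?_, fun t ht => ?_⟩
    · exact (hsol.hasDerivAt _ (hsub t ht)).scomp t (hd t)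
    · refine (((hsol.hasDerivAt_velocity _ (hsub t ht)).scomp t (hd t)).const_smul s).congr_deriv ?_
      simp [smul_smul]
  have hsv : s • v ∈ Φ.source := hball (by
    rw [mem_ball_zero_iff, norm_smul, Real.norm_of_nonneg hs.1]
    nlinarith [hs.2, norm_nonneg v])
  have h1 : pushVec Φ 0 (s • L v) = (s • v : E) :=
    ((pushVec Φ 0).map_smul s (L v)).trans (congrArg (fun w : E => s • w)
      (hP.pushVec_comp hΦ.zero_mem v))
  have key : ∀ z w, z = 0 → w = L v → (⟨Φ 0, s • v⟩ : TangentBundle 𝓘(ℝ, E) M) =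
      ⟨Φ z, pushVec Φ z (s • w)⟩ := by
    rintro _ _ rfl rfl
    exact congrArg (fun w : E => (⟨Φ 0, w⟩ : TangentBundle 𝓘(ℝ, E) M)) h1.symm
  have h2 := (hΦ.isExp _ hsv).eq_of_isGeodesicSol hsol' hΓ hP hΓs isOpen_Ioo
    (fun t ht => ⟨by linarith [ht.1], by linarith [ht.2]⟩) 
      (key _ _ (by rw [mul_zero, hc0]) (by rw [mul_zero, hu0]))
  rw [mul_one] at h2
  exact (Φ.injOn hsv (hsol.mem s ⟨by linarith [hs.1], by linarith [hs.2]⟩) h2).symm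

/-- The velocity along `s • v` is constantly `v`. Its limit at 0 identifies the initial velocity,
and its zero derivative enters the geodesic equation. -/
theorem exists_radial_eq : ∃ δ > 0, ∀ v : E, ‖v‖ ≤ δ →
    comp Φ (Φ 0) v = v ∧ ∀ s ∈ Ioo (0 : ℝ) 1, Γ (s • v) v v = 0 := by
  obtain ⟨δ, hδ, H⟩ := hΦ.exists_radial hΓ hΓs
  refine ⟨δ, hδ, fun v hv => ?_⟩
  obtain ⟨u, hu0, c, hsol, hc⟩ := H v hv
  have hsub : ∀ s ∈ Ioo (0 : ℝ) 1, s ∈ Ioo (-1 : ℝ) 2 := fun s hs =>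
    ⟨by linarith [hs.1], by linarith [hs.2]⟩
  have hu : ∀ s ∈ Ioo (0 : ℝ) 1, u s = v := fun s hs => by
    have h1 : HasDerivAt c v s := by
      have h2 := (hasDerivAt_id s).smul_const v
      rw [one_smul] at h2
      refine h2.congr_of_eventuallyEq ?_
      filter_upwards [Ioo_mem_nhds hs.1 hs.2] with t ht using hc t (Ioo_subset_Icc_self ht)
    exact (hsol.hasDerivAt s (hsub s hs)).unique h1
  constructor
  · rw [← hu0]
    have h1 : Tendsto u (𝓝[>] 0) (𝓝 (u 0)) :=
      (hsol.hasDerivAt_velocity 0 (by norm_num)).continuousAt.continuousWithinAt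
    refine tendsto_nhds_unique h1 (tendsto_const_nhds.congr' ?_)
    filter_upwards [Ioo_mem_nhdsGT one_pos] with s hs using (hu s hs).symm
  · intro s hs
    have h1 : HasDerivAt u 0 s := by
      refine (hasDerivAt_const s v).congr_of_eventuallyEq ?_
      filter_upwards [Ioo_mem_nhds hs.1 hs.2] with t ht using hu t ht
    have h2 := (hsol.hasDerivAt_velocity s (hsub s hs)).unique h1
    rwa [neg_eq_zero, hu s hs, hc s (Ioo_subset_Icc_self hs)] at h2

omit [FiniteDimensional ℝ E] [TopologicalSpace M] [ChartedSpace E M] [IsManifold 𝓘(ℝ, E) ∞ M]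
  [T2Space M] hΦ hΓ hΓs in
theorem exists_pos_norm_smul_le {δ : ℝ} (hδ : 0 < δ) (v : E) : ∃ r > (0 : ℝ), ‖r • v‖ ≤ δ := by
  refine ⟨δ / (‖v‖ + 1), by positivity, ?_⟩
  rw [norm_smul, Real.norm_of_nonneg (by positivity), div_mul_eq_mul_div,
    div_le_iff₀ (by positivity)]
  nlinarith [norm_nonneg v]

/-- The differential of the exponential map at the origin is the identity. -/
theorem pushVec_zero (v : E) : pushVec Φ 0 v = v := by
  obtain ⟨δ, hδ, H⟩ := hΦ.exists_radial_eq hΓ hΓs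
  obtain ⟨r, hr, hv⟩ := exists_pos_norm_smul_le hδ v
  set L : E →L[ℝ] E := comp Φ (Φ 0) with hL
  have h1 : L (r • v) = r • v := (H _ hv).1
  rw [map_smul] at h1
  have h2 : L v = v := smul_right_injective E hr.ne' h1
  have h3 : L (pushVec Φ 0 v) = v := hΦ.isParametrization.comp_pushVec hΦ.zero_mem v
  exact hΦ.isParametrization.comp_injective (Φ.map_source hΦ.zero_mem) (h3.trans h2.symm)

/-- `exists_radial_eq` holds for a small multiple `r • v`; homogeneity in the two vector arguments
then lets `r` be divided out. -/
theorem eventually_christoffel_eq_zero (v : E) : ∀ᶠ s in 𝓝[>] (0 : ℝ), Γ (s • v) v v = 0 := by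
  obtain ⟨δ, hδ, H⟩ := hΦ.exists_radial_eq hΓ hΓs
  obtain ⟨r, hr, hv⟩ := exists_pos_norm_smul_le hδ v
  filter_upwards [Ioo_mem_nhdsGT hr] with s hs
  have h1 := (H _ hv).2 (s / r) ⟨div_pos hs.1 hr, (div_lt_one hr).2 hs.2⟩
  rw [smul_smul, div_mul_cancel₀ _ hr.ne'] at h1
  simp only [map_smul, smul_apply, smul_eq_zero] at h1
  exact (h1.resolve_left hr.ne').resolve_left hr.ne'

/-- The Christoffel symbols vanish at the origin of normal coordinates. -/
theorem christoffel_zero (hs : ∀ z ∈ Φ.source, ∀ u v, Γ z u v = Γ z v u) : Γ 0 = 0 := by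
  have hc : ContinuousAt Γ 0 := hΓs.continuousOn.continuousAt (Φ.open_source.mem_nhds hΦ.zero_mem)
  have h1 : ∀ v, Γ 0 v v = 0 := fun v => by
    have h2 : Tendsto (fun s : ℝ => Γ (s • v) v v) (𝓝[>] 0) (𝓝 (Γ 0 v v)) := by
      have h3 : ContinuousAt (fun s : ℝ => Γ (s • v)) 0 :=
        ContinuousAt.comp (x := (0 : ℝ)) (f := fun s : ℝ => s • v) (by simpa using hc)
          (by fun_prop)
      have h4 := (h3.clm_apply (continuousAt_const (y := v))).clm_apply (continuousAt_const (y := v))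
      have := h4.tendsto.mono_left (nhdsWithin_le_nhds (s := Ioi 0))
      simpa using this
    exact tendsto_nhds_unique_of_eventuallyEq h2 tendsto_const_nhds
      (hΦ.eventually_christoffel_eq_zero hΓ hΓs v)
  ext u v
  have h2 := h1 (u + v)
  simp only [map_add, add_apply, h1, hs 0 hΦ.zero_mem v u] at h2
  have h3 : (2 : ℝ) • Γ 0 u v = 0 := by
    rw [two_smul]
    simpa using h2
  simpa using (smul_eq_zero.1 h3).resolve_left (by norm_num)

omit [IsManifold 𝓘(ℝ, E) ∞ M] [FiniteDimensional ℝ E] [T2Space M] hΦ hΓ hΓs in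
theorem hasDerivAt_apply_smul {A : E →L[ℝ] E →L[ℝ] E →L[ℝ] E} (hA : HasFDerivAt Γ A 0)
    (u v w : E) : HasDerivAt (fun s : ℝ => Γ (s • u) v w) (A u v w) 0 := by
  have h1 : HasDerivAt (fun s : ℝ => s • u) u 0 := by
    simpa using (hasDerivAt_id (0 : ℝ)).smul_const u
  have h2 : HasDerivAt (fun s : ℝ => Γ (s • u)) (A u) 0 :=
    HasFDerivAt.comp_hasDerivAt (x := (0 : ℝ)) (f := fun s : ℝ => s • u) (by simpa using hA) h1
  have h3 := (h2.clm_apply (hasDerivAt_const (0 : ℝ) v)).clm_apply (hasDerivAt_const (0 : ℝ) w)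
  simpa using h3

/-- The radial identity holds for positive `s` only, and a right derivative at 0 already determines
`A v v v`. -/
theorem fderiv_christoffel_diag {A : E →L[ℝ] E →L[ℝ] E →L[ℝ] E} (hA : HasFDerivAt Γ A 0)
    (h0 : Γ 0 = 0) (v : E) : A v v v = 0 := by
  have h1 := (hasDerivAt_apply_smul hA v v v).hasDerivWithinAt (s := Ici 0)
  have h2 : HasDerivWithinAt (fun s : ℝ => Γ (s • v) v v) 0 (Ici 0) 0 := by
    rw [← hasDerivWithinAt_Ioi_iff_Ici]
    exact (hasDerivWithinAt_const (0 : ℝ) (Ioi 0) (0 : E)).congr_of_eventuallyEq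
      (hΦ.eventually_christoffel_eq_zero hΓ hΓs v) (by simp [h0])
  exact (uniqueDiffWithinAt_Ici (0 : ℝ)).eq_deriv _ h1 h2

omit [FiniteDimensional ℝ E] [T2Space M] hΓ hΓs in
theorem fderiv_christoffel_symm {A : E →L[ℝ] E →L[ℝ] E →L[ℝ] E} (hA : HasFDerivAt Γ A 0)
    (hs : ∀ z ∈ Φ.source, ∀ u v, Γ z u v = Γ z v u) (x u v : E) : A x u v = A x v u := by
  refine (hasDerivAt_apply_smul hA x u v).unique
    ((hasDerivAt_apply_smul hA x v u).congr_of_eventuallyEq ?_)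
  have h1 : ContinuousAt (fun s : ℝ => s • x) 0 := by fun_prop
  filter_upwards [h1.preimage_mem_nhds (Φ.open_source.mem_nhds (by simpa using hΦ.zero_mem))]
    with s h using hs _ h u v

end IsRestrictedNormalNhd

end GeodesicLoop

/-! ### The loop product in normal coordinates, and the conclusion -/

namespace GeodesicLoop

open Filter Topology

variable {E : Type*} [NormedAddCommGroup E] [NormedSpace ℝ E] [FiniteDimensional ℝ E]
  {M : Type*} [TopologicalSpace M] [T2Space M] [ChartedSpace E M] [IsManifold 𝓘(ℝ, E) ∞ M]
  {cov : CovariantDerivative 𝓘(ℝ, E) E (TangentSpace 𝓘(ℝ, E) : M → Type _)}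
  {Φ : OpenPartialHomeomorph E M} {Γ : E → E →L[ℝ] E →L[ℝ] E}

namespace IsRestrictedNormalNhd

variable (hΦ : IsRestrictedNormalNhd cov (Φ 0) Φ) (hΓ : IsChristoffel cov Φ Γ)
  (hΓs : ContDiffOn ℝ ∞ Γ Φ.source)
include hΦ hΓ hΓs

/-- The product of the geodesic loop in normal coordinates, from solutions of the equations of
parallel transport and of geodesics. -/
theorem isProduct_of_isGeodesicSol {a b : E} (ha : a ∈ Φ.source) (hb : b ∈ Φ.source)
    {z u w z' u' : ℝ → E} (h : IsGeodesicSol Γ Φ.source z u (Ioo (-1) 2))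
    (hw : ∀ t ∈ Ioo (-1 : ℝ) 2, HasDerivAt w (-Γ (z t) (w t) (u t)) t)
    (hz : ContDiffOn ℝ ∞ z (Ioo (-1) 2)) (hws : ContDiffOn ℝ ∞ w (Ioo (-1) 2))
    (hzt : ∀ t ∈ Icc (0 : ℝ) 1, z t ∈ Φ.source) (hz0 : z 0 = 0) (hu0 : u 0 = b) (hw0 : w 0 = a)
    (h' : IsGeodesicSol Γ Φ.source z' u' (Ioo (-1) 2)) (hz' : ContDiffOn ℝ ∞ z' (Ioo (-1) 2))
    (hz0' : z' 0 = b) (hu0' : u' 0 = w 1) :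
    IsProduct cov (Φ 0) Φ (Φ a) (Φ b) (Φ (z' 1)) := by
  have hP := hΦ.isParametrization
  have hsub : Icc (0 : ℝ) 1 ⊆ Ioo (-1) 2 := fun t ht => ⟨by linarith [ht.1], by linarith [ht.2]⟩
  have h0 : (0 : ℝ) ∈ Ioo (-1 : ℝ) 2 := by norm_num
  have h1 : (1 : ℝ) ∈ Ioo (-1 : ℝ) 2 := by norm_num
  have key : ∀ z v : E, z = 0 → (⟨Φ 0, v⟩ : TangentBundle 𝓘(ℝ, E) M) = ⟨Φ z, pushVec Φ z v⟩ := by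
    rintro _ v rfl
    exact congrArg (fun w : E => (⟨Φ 0, w⟩ : TangentBundle 𝓘(ℝ, E) M))
      (hΦ.pushVec_zero hΓ hΓs v).symm
  -- The solution starting at the origin with velocity `b` ends at the exponential of `b`, so it is
  -- the segment along which the product transports.
  have hb1 : Φ b = Φ (z 1) := (hΦ.isExp b hb).eq_of_isGeodesicSol h hΓ hP hΓs isOpen_Ioo hsub
    ((key _ _ hz0).trans (by rw [hu0]))
  have hz1 : z 1 = b := (Φ.injOn hb (h.mem 1 h1) hb1).symm
  refine ⟨Φ.map_source ha, Φ.map_source hb, Φ.map_source (h'.mem 1 h1), Ioo (-1) 2,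
    fun t => Φ (z t), fun t => pushVec Φ (z t) (w t),
    ⟨isOpen_Ioo, hsub, h.isGeodesicOn hΓ hP isOpen_Ioo hz, congrArg Φ hz0, hb1.symm,
      fun t ht => Φ.map_source (hzt t ht)⟩,
    h.isParallelOn hΓ hP isOpen_Ioo hz hws hw, ?_, Ioo (-1) 2, fun t => Φ (z' t), isOpen_Ioo,
    hsub, h'.isGeodesicOn hΓ hP isOpen_Ioo hz', ?_, rfl⟩
  · refine (key _ _ hz0).symm.trans ?_
    exact congrArg (fun w : E => (⟨Φ 0, w⟩ : TangentBundle 𝓘(ℝ, E) M))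
      (hw0.trans (Φ.left_inv ha).symm)
  · have e1 := h'.velocity_eq hP h0
    have e2 : ∀ x y v : E, x = y → (⟨Φ x, pushVec Φ x v⟩ : TangentBundle 𝓘(ℝ, E) M) =
        ⟨Φ y, pushVec Φ y v⟩ := by
      rintro x _ v rfl
      rfl
    refine (congrArg (fun ξ : TangentSpace 𝓘(ℝ, E) (Φ (z' 0)) =>
      (⟨Φ (z' 0), ξ⟩ : TangentBundle 𝓘(ℝ, E) M)) e1).trans ?_
    rw [hu0']
    exact e2 _ _ _ (hz0'.trans hz1.symm)

/-- The product of the geodesic loop to third order, in normal coordinates. -/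
theorem exists_isProduct (h0 : Γ 0 = 0) {A : E →L[ℝ] E →L[ℝ] E →L[ℝ] E}
    (hA : HasFDerivAt Γ A 0) {ρ : ℝ} (hρ : 0 < ρ) :
    ∃ δ > 0, ∀ N ≤ δ, ∀ a b, ‖a‖ ≤ N → ‖b‖ ≤ N → ∃ m,
      (m ∈ Φ.source ∧ IsProduct cov (Φ 0) Φ (Φ a) (Φ b) (Φ m)) ∧
      ‖m - (a + b - (1 / 2 : ℝ) • A b a b - (1 / 2 : ℝ) • A b a a)‖ ≤ ρ * N ^ 3 := by
  obtain ⟨δ₀, hδ₀, C, hC, H⟩ := exists_isGeodesicSol Φ.open_source hΦ.zero_mem hΓs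
  obtain ⟨r, hr, hball⟩ := Metric.mem_nhds_iff.1 (Φ.open_source.mem_nhds hΦ.zero_mem)
  -- The second geodesic starts with data `b` and `w 1`, of sizes `N` and `C * N`; both are at most
  -- `C₁ * N`.
  set C₁ := C + 1 with hC₁
  have hC₁0 : 0 < C₁ := by positivity
  set ρ₁ := min 1 (ρ / 4) with hρ₁
  have hρ₁0 : 0 < ρ₁ := by positivity
  obtain ⟨δ₁, hδ₁, H₁⟩ := parallel_expansion h0 hA hC hρ₁0
  obtain ⟨δ₂, hδ₂, H₂⟩ := geodesic_expansion h0 hA hC (ρ := ρ / (4 * C₁ ^ 3)) (by positivity)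
  set K := 3 * ‖A‖ * C₁ ^ 2 * (1 + ‖A‖) with hK
  have hK0 : 0 ≤ K := by positivity
  refine ⟨min 1 (min (δ₀ / C₁) (min δ₁ (min (δ₂ / C₁) (min (r / 2) (ρ / (K + 1)))))),
    by positivity, fun N hN a b ha hb => ?_⟩
  have hN0 : 0 ≤ N := (norm_nonneg _).trans ha
  simp only [le_min_iff] at hN
  obtain ⟨hN1, hNδ₀, hNδ₁, hNδ₂, hNr, hNK⟩ := hN
  rw [le_div_iff₀ hC₁0, mul_comm] at hNδ₀ hNδ₂
  rw [le_div_iff₀ (by positivity)] at hNK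
  have hNC : N ≤ C₁ * N := le_mul_of_one_le_left hN0 (by linarith)
  have hCC : C * N ≤ C₁ * N := by gcongr; linarith
  have hsub : Icc (0 : ℝ) 1 ⊆ Ioo (-1) 2 := fun t ht => ⟨by linarith [ht.1], by linarith [ht.2]⟩
  have h1I : (1 : ℝ) ∈ Icc (0 : ℝ) 1 := by norm_num
  obtain ⟨z, u, w, hz0, hu0, hw0, h, hw, hz, hws, hbd⟩ := H N (hNC.trans hNδ₀) 0 b a
    (by simpa using hN0) hb ha
  have hw1 : ‖w 1‖ ≤ C₁ * N := (hbd 1 h1I).2.2.trans hCC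
  obtain ⟨z', u', w', hz0', hu0', -, h', -, hz', -, hbd'⟩ := H (C₁ * N) hNδ₀ b (w 1) 0
    (hb.trans hNC) hw1 (by simpa using hN0.trans hNC)
  have hsrc : ∀ v, ‖v‖ ≤ N → v ∈ Φ.source := fun v hv => hball (by
    rw [mem_ball_zero_iff]
    linarith)
  refine ⟨z' 1, ⟨h'.mem 1 (hsub h1I), hΦ.isProduct_of_isGeodesicSol hΓ hΓs (hsrc a ha) (hsrc b hb)
    h hw hz hws (fun t ht => h.mem t (hsub ht)) hz0 hu0 hw0 h' hz' hz0' hu0'⟩, ?_⟩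
  have e1 := H₁ N hN0 hNδ₁ z u w (fun t ht => h.hasDerivAt t (hsub ht))
    (fun t ht => h.hasDerivAt_velocity t (hsub ht)) (fun t ht => hw t (hsub ht)) hbd 1 h1I
  have e2 := H₂ (C₁ * N) (hN0.trans hNC) hNδ₂ z' u' (fun t ht => h'.hasDerivAt t (hsub ht))
    (fun t ht => h'.hasDerivAt_velocity t (hsub ht))
    (fun t ht => ⟨(hbd' t ht).1, (hbd' t ht).2.1⟩)
  have hdiag := hΦ.fderiv_christoffel_diag hΓ hΓs hA h0
  rw [hz0, hu0, hw0, map_zero, zero_apply, zero_apply, smul_zero, sub_zero, one_pow] at e1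
  rw [hz0', hu0', hdiag, smul_zero, sub_zero] at e2
  have hN30 : 0 ≤ N ^ 3 := by positivity
  have e3 : ‖w 1 - a‖ ≤ (1 + ‖A‖) * N ^ 3 := by
    have h2 : ‖(1 / 2 : ℝ) • A b a b‖ ≤ 1 / 2 * (‖A‖ * N ^ 3) := by
      rw [norm_smul, Real.norm_of_nonneg (by norm_num)]
      gcongr
      calc ‖A b a b‖ ≤ ‖A b‖ * ‖a‖ * ‖b‖ := (A b).le_opNorm₂ a b
        _ ≤ (‖A‖ * N) * N * N := by
          gcongr
          exact (A.le_opNorm b).trans (by gcongr)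
        _ = _ := by ring
    have h3 : w 1 - a = (w 1 - (a - (1 / 2 : ℝ) • A b a b)) - (1 / 2 : ℝ) • A b a b := by abel
    rw [h3]
    refine (norm_sub_le_of_le e1 h2).trans ?_
    have : ρ₁ * N ^ 3 ≤ 1 * N ^ 3 := by gcongr; exact min_le_left _ _
    have : 0 ≤ ‖A‖ * N ^ 3 := by positivity
    linarith
  -- Since `w 1 - a` is cubic, replacing `w 1` by `a` in the quadratic slots costs only fifth order.
  have e4 := norm_trilinear_sub_le A (x := b) (x' := b) (by rw [sub_self, norm_zero]; positivity)
    e3 e3 (hb.trans hNC) hw1 (ha.trans hNC) hw1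
  have e5 : z' 1 - (a + b - (1 / 2 : ℝ) • A b a b - (1 / 2 : ℝ) • A b a a) =
      (z' 1 - (b + w 1 - (1 / 2 : ℝ) • A b (w 1) (w 1))) +
      (w 1 - (a - (1 / 2 : ℝ) • A b a b)) -
      (1 / 2 : ℝ) • (A b (w 1) (w 1) - A b a a) := by module
  rw [e5]
  refine (norm_sub_le_of_le (norm_add_le_of_le e2 e1) ((norm_smul_le _ _).trans
    (mul_le_mul_of_nonneg_left e4 (norm_nonneg _)))).trans ?_
  have f1 : ρ / (4 * C₁ ^ 3) * (C₁ * N) ^ 3 = ρ / 4 * N ^ 3 := by field_simp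
  have f2 : ρ₁ * N ^ 3 ≤ ρ / 4 * N ^ 3 := by gcongr; exact min_le_right _ _
  have f3 : K * N ^ 2 ≤ ρ := by
    have : N ^ 2 ≤ N := pow_le_of_le_one hN0 hN1 (by norm_num)
    calc K * N ^ 2 ≤ K * N := by gcongr
      _ ≤ N * (K + 1) := by linarith
      _ ≤ ρ := hNK
  have f4 : 3 * ‖A‖ * (C₁ * N) ^ 2 * ((1 + ‖A‖) * N ^ 3) ≤ ρ * N ^ 3 := by
    calc _ = K * N ^ 2 * N ^ 3 := by rw [hK]; ring
      _ ≤ _ := by gcongr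
  rw [f1, Real.norm_of_nonneg (by norm_num)]
  linarith

end IsRestrictedNormalNhd

/-- A torsion-free connection whose geodesic loop at `e` is left diassociative is flat at `e`. -/
theorem curvature_eq_zero_of_isLeftDiassociative
    (hcov : CovariantDerivative.ContMDiffCovariantDerivative cov ∞)
    (htorsion : haveI : IsManifold 𝓘(ℝ, E) 2 M := .of_le (n := ∞) two_le_infty
      cov.torsion = 0)
    {e : M} (hΦ : IsRestrictedNormalNhd cov e Φ) (hd : IsLeftDiassociative cov e Φ)
    {X Y Z : ∀ p : M, TangentSpace 𝓘(ℝ, E) p}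
    (hX : ContMDiff 𝓘(ℝ, E) 𝓘(ℝ, E).tangent ∞
      (fun p => (⟨p, X p⟩ : TangentBundle 𝓘(ℝ, E) M)))
    (hY : ContMDiff 𝓘(ℝ, E) 𝓘(ℝ, E).tangent ∞
      (fun p => (⟨p, Y p⟩ : TangentBundle 𝓘(ℝ, E) M)))
    (hZ : ContMDiff 𝓘(ℝ, E) 𝓘(ℝ, E).tangent ∞
      (fun p => (⟨p, Z p⟩ : TangentBundle 𝓘(ℝ, E) M))) :
    curvature cov X Y Z e = 0 := by
  have he := hΦ.apply_zero hcov
  subst he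
  have hP := hΦ.isParametrization
  obtain ⟨Γ, hΓ⟩ := hP.exists_isChristoffel cov
  have hΓs := hΓ.contDiffOn hP hcov
  have hs : ∀ z ∈ Φ.source, ∀ u v, Γ z u v = Γ z v u := fun z hz u v =>
    hΓ.symm_of_torsion_eq_zero hP htorsion hz u v
  have h0 := hΦ.christoffel_zero hΓ hΓs hs
  have hA : HasFDerivAt Γ (fderiv ℝ Γ 0) 0 :=
    ((hΓs.contDiffAt (Φ.open_source.mem_nhds hΦ.zero_mem)).differentiableAt (by simp)).hasFDerivAt
  have hdiag := hΦ.fderiv_christoffel_diag hΓ hΓs hA h0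
  have hA0 : fderiv ℝ Γ 0 = 0 := by
    refine trilinear_eq_zero _ hdiag (hΦ.fderiv_christoffel_symm hA hs)
      (trilinear_symm_of_product _ hdiag
        (fun ρ hρ => hΦ.exists_isProduct hΓ hΓs h0 hA hρ) ?_)
    -- The product predicate includes membership in `Φ.source`, so equality of points on `M` pulls
    -- back to coordinates.
    intro x y xy xx r s h1 h2 h3 h4
    exact Φ.injOn h2.1 h4.1 (hd _ _ _ _ _ _ h1.2 h2.2 h3.2 h4.2)
  rw [hA0] at hA
  exact hΓ.curvature_eq_zero hP hcov hΦ.zero_mem h0 hA hX hY hZ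

end GeodesicLoop

end

theorem theorem3p23 {n : ℕ} {M : Type*} [TopologicalSpace M] [T2Space M]
    [ChartedSpace (EuclideanSpace ℝ (Fin n)) M]
    [IsManifold (𝓡 n) ∞ M]
    (cov : CovariantDerivative (𝓡 n) (EuclideanSpace ℝ (Fin n))
      (TangentSpace (𝓡 n) : M → Type _))
    (hcov : CovariantDerivative.ContMDiffCovariantDerivative cov ∞)
    (htorsion : cov.torsion = 0)
    (e : M) (Φ : OpenPartialHomeomorph (EuclideanSpace ℝ (Fin n)) M)
    (hΦ : GeodesicLoop.IsRestrictedNormalNhd cov e Φ)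
    (hdiassoc : GeodesicLoop.IsLeftDiassociative cov e Φ)
    (X Y Z : ∀ p : M, TangentSpace (𝓡 n) p)
    (hX : ContMDiff (𝓡 n) (𝓡 n).tangent ∞
      (fun p => (⟨p, X p⟩ : TangentBundle (𝓡 n) M)))
    (hY : ContMDiff (𝓡 n) (𝓡 n).tangent ∞
      (fun p => (⟨p, Y p⟩ : TangentBundle (𝓡 n) M)))
    (hZ : ContMDiff (𝓡 n) (𝓡 n).tangent ∞
      (fun p => (⟨p, Z p⟩ : TangentBundle (𝓡 n) M))) :
    GeodesicLoop.curvature cov X Y Z e = 0 := by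
  exact GeodesicLoop.curvature_eq_zero_of_isLeftDiassociative hcov htorsion hΦ hdiassoc hX hY hZ
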